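/- **Conventions.** $B_n$ is the braid group with generators $\sigma_1,\dots,\sigma_{n-1}$ and relations $\sigma_i\sigma_j=\sigma_j\sigma_i$ ($|i-j|>1$), $\sigma_i\sigma_j\sigma_i=\sigma_j\sigma_i\sigma_j$ ($|i-j|=1$). $B_{n,m}\le B_{n+m}$ is the subgroup of braids whose permutation preserves $\{1,\dots,n\}$. $F_N$ is the free group on $g_1,\dots,g_N$, and $F_N\rtimes B_N$ is the semidirect product with $g_{i+1}\sigma_i=\sigma_ig_i$, $g_i\sigma_i=\sigma_i\,g_ig_{i+1}g_i^{-1}$, and $g_j\sigma_i=\sigma_ig_j$ for $j\notin\{i,i+1\}$. Let $$\phi\colon B_N\to \mathrm{GL}_N(\mathbf Z[F_N\rtimes B_N]),\qquad \phi(\sigma_i)=\sigma_i\cdot\mathrm{diag}(I_{i-1},R_i,I_{N-i-1}),\quad R_i=\begin{pmatrix}0&g_i\\1&1-g_i\end{pmatrix}.$$ Let $\iota\colon F_N\rtimes B_N\to B_{N+1}$ be the homomorphism with $\iota(\sigma_i)=\sigma_i$ and $\iota(g_i)=(\sigma_N\cdots\sigma_{i+1})\sigma_i^2(\sigma_N\cdots\sigma_{i+1})^{-1}$.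 For $N=n+m$ it maps $F_{n+m}\rtimes B_{n,m}$ into $B_{n,m+1}$. Given a representation $\rho\colon B_{n,m+1}\to\mathrm{GL}(W)$, its *Long–Moody step* is the representation $\rho^+\colon B_{n,m}\to\mathrm{GL}(W^{\oplus(n+m)})$ for which $\rho^+(\beta)$ is the block matrix obtained by applying $\rho\circ\iota$ to the entries of $\phi(\beta)$, which lie in $\mathbf Z[F_{n+m}\rtimes B_{n,m}]$. **Theorem.** (1) Let $n,m\ge 0$, let $V$ be a complex vector space, let $\rho\colon B_m\to\mathrm{GL}(V)$ be a representation, and let $k=(n+m-1)(n+m-2)\cdots(n+1)n$. There is a unique family of representations $\rho^+_q\colon B_n\to\mathrm{GL}(V^{\oplus k})$, $q\in\mathbf C^*$, such that for every $q$ the representation $\rho^+_q$ arises as follows: there is a representation $\rho'\colon B_{n,m}\to\mathrm{GL}(V)$ with $\rho'(\sigma_i)=1$ for $1\le i\le n-1$, $\rho'(\sigma_n^2)=q$ (if $n,m\ge1$) and $\rho'(\sigma_{n+i})=\rho(\sigma_i)$ for $1\le i\le m-1$, and $\rho^+_q$ is obtained from $\rho'$ by $m$ successive Long–Moody steps $B_{n,m},B_{n,m-1},\dots,B_{n,0}=B_n$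 (with the standard identification of the iterated direct sum with $V^{\oplus k}$). (2) Let $m=2$, $V=\mathbf C$ and $\rho(\sigma_1)=t\in\mathbf C^*$. Then for all $n$ and all $q,t\in\mathbf C^*$ the representation $\rho^+_q$, of dimension $n(n+1)$, contains the Lawrence–Krammer representation of $B_n$ with parameters $q,t$ as a subrepresentation: there is an injective $B_n$-equivariant linear map from it to $\mathbf C^{k}$. Here the Lawrence–Krammer representation is the representation on the space with basis $x_{i,j}$, $1\le i<j\le n$, given by $$\sigma_k x_{i,j}=\begin{cases} q\,x_{k,j}+(q^2-q)\,x_{k,i}+(1-q)\,x_{i,j} & k=i-1,\\ -t q^2\,x_{i,j} & k=i=j-1,\\ x_{i+1,j} & k=i\ne j-1,\\ q\,x_{i,k}+(1-q)\,x_{i,j}-(q^2-q)t\,x_{k,j} & k=j-1\ne i,\\ x_{i,j+1} & k=j,\\ x_{i,j} & \text{otherwise.} \end{cases}$$ -/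

import Mathlib

noncomputable section

namespace LongMoody

/-! ### Braid groups

Generators are indexed from `0`: for `i + 1 < n` the generator `σ i` braids the strands in
positions `i` and `i + 1` (so it is `σ_{i+1}` in the usual numbering from `1`). -/

/-- Index set of the generators of the braid group on `n` strands. -/
abbrev Gen (n : ℕ) : Type := {i : ℕ // i + 1 < n}

/-- The braid relations. -/
def braidRels (n : ℕ) : Set (FreeGroup (Gen n)) :=
  {r | (∃ i j : Gen n, i.1 + 1 < j.1 ∧
          r = (FreeGroup.of i * FreeGroup.of j) * (FreeGroup.of j * FreeGroup.of i)⁻¹) ∨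
       (∃ i j : Gen n, i.1 + 1 = j.1 ∧
          r = (FreeGroup.of i * FreeGroup.of j * FreeGroup.of i) *
              (FreeGroup.of j * FreeGroup.of i * FreeGroup.of j)⁻¹)}

/-- The braid group on `n` strands, by Artin's presentation. -/
abbrev BraidGroup (n : ℕ) : Type := PresentedGroup (braidRels n)

/-- The standard generators. -/
def σ {n : ℕ} (i : ℕ) (h : i + 1 < n) : BraidGroup n := PresentedGroup.of ⟨i, h⟩

theorem σ_comm {n i j : ℕ} (hi : i + 1 < n) (hj : j + 1 < n) (h : i + 1 < j) :
    σ i hi * σ j hj = σ j hj * σ i hi := by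
  have := PresentedGroup.one_of_mem (rels := braidRels n)
    (Or.inl ⟨⟨i, hi⟩, ⟨j, hj⟩, h, rfl⟩)
  simp only [map_mul, map_inv] at this
  exact mul_inv_eq_one.mp this

theorem σ_braid {n i : ℕ} (h : i + 1 + 1 < n) :
    σ i (by omega) * σ (i + 1) h * σ i (by omega) =
      σ (i + 1) h * σ i (by omega) * σ (i + 1) h := by
  have := PresentedGroup.one_of_mem (rels := braidRels n)
    (Or.inr ⟨⟨i, by omega⟩, ⟨i + 1, h⟩, rfl, rfl⟩)
  simp only [map_mul, map_inv] at this
  exact mul_inv_eq_one.mp this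

/-- A map of the generators that respects the braid relations extends to a homomorphism. -/
def braidLift {G : Type*} [Group G] {n : ℕ} (f : ∀ i : ℕ, i + 1 < n → G)
    (hc : ∀ i j (hi : i + 1 < n) (hj : j + 1 < n), i + 1 < j → f i hi * f j hj = f j hj * f i hi)
    (hb : ∀ i (h : i + 1 + 1 < n),
      f i (by omega) * f (i + 1) h * f i (by omega) =
        f (i + 1) h * f i (by omega) * f (i + 1) h) :
    BraidGroup n →* G :=
  PresentedGroup.toGroup (f := fun i : Gen n => f i.1 i.2) (by
    rintro r (⟨i, j, h, rfl⟩ | ⟨⟨i, hi⟩, ⟨j, hj⟩, h, rfl⟩)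
    · simp only [map_mul, map_inv, FreeGroup.lift_apply_of]
      exact mul_inv_eq_one.mpr (hc _ _ _ _ h)
    · simp only at h
      subst h
      simp only [map_mul, map_inv, FreeGroup.lift_apply_of]
      exact mul_inv_eq_one.mpr (hb _ _))

theorem braidLift_σ {G : Type*} [Group G] {n : ℕ} (f : ∀ i : ℕ, i + 1 < n → G) (hc) (hb)
    (i : ℕ) (h : i + 1 < n) : braidLift f hc hb (σ i h) = f i h :=
  PresentedGroup.toGroup.of _

theorem swap_braid {α : Type*} [DecidableEq α] {x y z : α} (h1 : x ≠ y) (h2 : x ≠ z)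
    (h3 : y ≠ z) : Equiv.swap x y * Equiv.swap y z * Equiv.swap x y =
      Equiv.swap y z * Equiv.swap x y * Equiv.swap y z := by
  rw [Equiv.swap_mul_swap_mul_swap h1 h2, Equiv.swap_comm y z, Equiv.swap_comm x y,
    Equiv.swap_mul_swap_mul_swap h3.symm h2.symm, Equiv.swap_comm]

/-- The underlying permutation of the strands of a braid. -/
def strandPerm (n : ℕ) : BraidGroup n →* Equiv.Perm (Fin n) :=
  braidLift (fun i h => Equiv.swap ⟨i, by omega⟩ ⟨i + 1, h⟩)
    (by
      intro i j hi hj h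
      refine Equiv.Perm.Disjoint.commute ?_
      intro x
      by_cases hx : x.1 = i ∨ x.1 = i + 1
      · right
        apply Equiv.swap_apply_of_ne_of_ne <;> (intro e; subst e; simp at hx; omega)
      · left
        apply Equiv.swap_apply_of_ne_of_ne <;> (intro e; subst e; simp at hx))
    (by
      intro i h
      exact swap_braid (by simp) (by simp; omega) (by simp))

open Pointwise in
/-- `B_{n,m}`: the braids on `n + m` strands that connect the first `n` nodes at the bottom to
the first `n` nodes at the top. -/
def mixedBraid (n m : ℕ) : Subgroup (BraidGroup (n + m)) :=
  (MulAction.stabilizer (Equiv.Perm (Fin (n + m))) {x : Fin (n + m) | x.1 < n}).comap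
    (strandPerm (n + m))

/-! ### The semidirect product `F_N ⋊ B_N` -/

/-- The free generators `g_i` of `F_N`, with `i < N`. -/
abbrev g {N : ℕ} (i : ℕ) (h : i < N) : FreeGroup (Fin N) := FreeGroup.of ⟨i, h⟩

/-- The automorphism `w ↦ σ_i w σ_i⁻¹` of `F_N`:
`g_i ↦ g_{i+1}`, `g_{i+1} ↦ g_{i+1}⁻¹ g_i g_{i+1}`, `g_j ↦ g_j` for `j ≠ i, i + 1`. It encodes
the relations `g_{i+1} σ_i = σ_i g_i`, `g_i σ_i = σ_i g_i g_{i+1} g_i⁻¹` and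
`g_j σ_i = σ_i g_j`. -/
def artinGen {N : ℕ} (i : ℕ) (h : i + 1 < N) : MulAut (FreeGroup (Fin N)) :=
  MonoidHom.toMulEquiv
    (FreeGroup.lift fun j => if j.1 = i then g (i + 1) h
      else if j.1 = i + 1 then (g (i + 1) h)⁻¹ * g i (by omega) * g (i + 1) h
      else FreeGroup.of j)
    (FreeGroup.lift fun j => if j.1 = i then g i (by omega) * g (i + 1) h * (g i (by omega))⁻¹
      else if j.1 = i + 1 then g i (by omega)
      else FreeGroup.of j)
    (by
      ext ⟨j, hj⟩
      by_cases h1 : j = i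
      · subst h1; simp
      · by_cases h2 : j = i + 1
        · subst h2; simp [mul_assoc]
        · simp [h1, h2])
    (by
      ext ⟨j, hj⟩
      by_cases h1 : j = i
      · subst h1; simp [mul_assoc]
      · by_cases h2 : j = i + 1
        · subst h2; simp
        · simp [h1, h2])

theorem artinGen_self {N : ℕ} (i : ℕ) (h : i + 1 < N) :
    artinGen i h (g i (by omega)) = g (i + 1) h := by
  simp [artinGen]

theorem artinGen_succ {N : ℕ} (i : ℕ) (h : i + 1 < N) :
    artinGen i h (g (i + 1) h) = (g (i + 1) h)⁻¹ * g i (by omega) * g (i + 1) h := by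
  simp [artinGen]

theorem artinGen_ne {N : ℕ} (i : ℕ) (h : i + 1 < N) (j : ℕ) (hj : j < N) (h1 : j ≠ i)
    (h2 : j ≠ i + 1) : artinGen i h (g j hj) = g j hj := by
  simp [artinGen, h1, h2]

theorem mulAut_ext {N : ℕ} {a b : MulAut (FreeGroup (Fin N))}
    (h : ∀ j hj, a (g j hj) = b (g j hj)) : a = b := by
  have : a.toMonoidHom = b.toMonoidHom := FreeGroup.ext_hom _ _ fun j => h j.1 j.2
  exact MulEquiv.toMonoidHom_injective this

/-- The action of the braid group `B_N` on the free group `F_N`. -/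
def artin (N : ℕ) : BraidGroup N →* MulAut (FreeGroup (Fin N)) :=
  braidLift (fun i h => artinGen i h)
    (by
      intro i j hi hj h
      apply mulAut_ext
      intro a ha
      simp only [MulAut.mul_apply]
      have n1 := artinGen_ne i hi
      have n2 := artinGen_ne j hj
      have s1 := artinGen_self i hi
      have s2 := artinGen_self j hj
      have t1 := artinGen_succ i hi
      have t2 := artinGen_succ j hj
      have n11 := n1 j (by omega) (by omega) (by omega)
      have n12 := n1 (j + 1) (by omega) (by omega) (by omega)
      have n21 := n2 i (by omega) (by omega) (by omega)
      have n22 := n2 (i + 1) (by omega) (by omega) (by omega)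
      by_cases c1 : a = i
      · subst c1; simp only [*]
      by_cases c2 : a = i + 1
      · subst c2; simp only [*, map_mul, map_inv]
      by_cases c3 : a = j
      · subst c3; simp only [*]
      by_cases c4 : a = j + 1
      · subst c4; simp only [*, map_mul, map_inv]
      rw [n1 a ha c1 c2, n2 a ha c3 c4, n1 a ha c1 c2])
    (by
      intro i h
      apply mulAut_ext
      intro a ha
      simp only [MulAut.mul_apply]
      have n1 := artinGen_ne i (N := N) (by omega)
      have n2 := artinGen_ne (i + 1) h
      have s1 := artinGen_self i (N := N) (by omega)
      have s2 := artinGen_self (i + 1) h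
      have t1 := artinGen_succ i (N := N) (by omega)
      have t2 := artinGen_succ (i + 1) h
      have n11 := n1 (i + 1 + 1) (by omega) (by omega) (by omega)
      have n22 := n2 i (by omega) (by omega) (by omega)
      by_cases c1 : a = i
      · subst c1; simp only [s1, s2, n11, n22]
      by_cases c2 : a = i + 1
      · subst c2; simp only [s1, s2, t1, t2, n11, n22, map_mul, map_inv]
      by_cases c3 : a = i + 1 + 1
      · subst c3; simp only [s2, t1, t2, n11, n22, map_mul, map_inv]; group
      simp only [n1 a ha c1 c2, n2 a ha c2 c3])

theorem artin_σ {N : ℕ} (i : ℕ) (h : i + 1 < N) : artin N (σ i h) = artinGen i h :=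
  braidLift_σ _ _ _ _ _

/-- The semidirect product `F_N ⋊ B_N`. -/
abbrev FB (N : ℕ) : Type := FreeGroup (Fin N) ⋊[artin N] BraidGroup N

/-- The generator `g_i`, as an element of `F_N ⋊ B_N`. -/
def gg {N : ℕ} (i : ℕ) (h : i < N) : FB N := SemidirectProduct.inl (g i h)

/-- The generator `σ_i`, as an element of `F_N ⋊ B_N`. -/
def ss {N : ℕ} (i : ℕ) (h : i + 1 < N) : FB N := SemidirectProduct.inr (σ i h)

theorem FB_rel {N : ℕ} (i : ℕ) (h : i + 1 < N) (w : FreeGroup (Fin N)) :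
    ss i h * SemidirectProduct.inl w = SemidirectProduct.inl (artinGen i h w) * ss i h := by
  rw [← artin_σ, SemidirectProduct.inl_aut, ss]
  simp

/-- `g_{i+1} σ_i = σ_i g_i`. -/
theorem rel_succ {N : ℕ} (i : ℕ) (h : i + 1 < N) :
    gg (i + 1) h * ss i h = ss i h * gg i (by omega) := by
  rw [gg, gg, FB_rel, artinGen_self]

/-- `g_i σ_i = σ_i g_i g_{i+1} g_i⁻¹`. -/
theorem rel_self {N : ℕ} (i : ℕ) (h : i + 1 < N) :
    gg i (by omega) * ss i h =
      ss i h * (gg i (by omega) * gg (i + 1) h * (gg i (by omega))⁻¹) := by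
  simp only [gg]
  rw [← map_inv, ← map_mul, ← map_mul, FB_rel]
  simp only [map_mul, map_inv, artinGen_self, artinGen_succ]
  group

/-- `g_j σ_i = σ_i g_j` if `j ∉ {i, i + 1}`. -/
theorem rel_ne {N : ℕ} (i : ℕ) (h : i + 1 < N) (j : ℕ) (hj : j < N) (h1 : j ≠ i)
    (h2 : j ≠ i + 1) : gg j hj * ss i h = ss i h * gg j hj := by
  rw [gg, FB_rel, artinGen_ne _ _ _ _ h1 h2]

/-! ### The homomorphism `F_N ⋊ B_N → B_{N+1}` -/

/-- The inclusion `B_N → B_{N+1}`, `σ_i ↦ σ_i`. -/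
def braidIncl (N : ℕ) : BraidGroup N →* BraidGroup (N + 1) :=
  braidLift (fun i h => σ i (by omega)) (fun _ _ _ _ h => σ_comm _ _ h)
    (fun _ _ => σ_braid _)

theorem braidIncl_σ {N i : ℕ} (h : i + 1 < N) : braidIncl N (σ i h) = σ i (by omega) :=
  braidLift_σ _ _ _ _ _

/-- The product `σ_{N-1} σ_{N-2} ⋯ σ_{i+1}` in `B_{N+1}` (generators numbered from `0`; the
empty product for `i + 1 ≥ N`). -/
def descProd (N i : ℕ) : BraidGroup (N + 1) :=
  if h : i + 1 < N then descProd N (i + 1) * σ (i + 1) (by omega) else 1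
termination_by N - i

theorem descProd_of_lt {N i : ℕ} (h : i + 1 < N) :
    descProd N i = descProd N (i + 1) * σ (i + 1) (by omega) := by
  rw [descProd, dif_pos h]

theorem descProd_of_not {N i : ℕ} (h : ¬ i + 1 < N) : descProd N i = 1 := by
  rw [descProd, dif_neg h]

/-- The pure braid `(σ_{N-1} ⋯ σ_{i+1}) σ_i² (σ_{N-1} ⋯ σ_{i+1})⁻¹` of `B_{N+1}`, whose first
`N` strands are straight. -/
def pureGen (N i : ℕ) (h : i < N) : BraidGroup (N + 1) :=
  descProd N i * σ i (by omega) ^ 2 * (descProd N i)⁻¹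

theorem descProd_comm {N i j : ℕ} (h : i + 1 < N + 1) (hij : i < j) :
    σ i h * descProd N j = descProd N j * σ i h := by
  induction hd : N - j generalizing j with
  | zero => rw [descProd_of_not (by omega)]; simp
  | succ d ih =>
    by_cases hj : j + 1 < N
    · rw [descProd_of_lt hj, ← mul_assoc, ih (by omega) (by omega), mul_assoc, mul_assoc,
        σ_comm _ _ (by omega)]
    · rw [descProd_of_not hj]; simp

theorem descProd_shift {N i j : ℕ} (h : i + 1 < N) (hij : j < i) :
    σ i (by omega) * descProd N j = descProd N j * σ (i + 1) (by omega) := by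
  induction hd : i - j generalizing j with
  | zero => omega
  | succ d ih =>
    by_cases e : i = j + 1
    · subst e
      rw [descProd_of_lt (i := j) (by omega), descProd_of_lt h, ← mul_assoc, ← mul_assoc,
        descProd_comm _ (by omega), mul_assoc, mul_assoc, mul_assoc, mul_assoc,
        ← mul_assoc (σ (j + 1) _), σ_braid, mul_assoc]
    · rw [descProd_of_lt (i := j) (by omega), ← mul_assoc, ih (by omega) (by omega), mul_assoc,
        mul_assoc, σ_comm (i := j + 1) _ _ (by omega)]

theorem pureGen_succ {N i : ℕ} (h : i + 1 < N) :
    pureGen N (i + 1) h * σ i (by omega) = σ i (by omega) * pureGen N i (by omega) := by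
  have hD := descProd_comm (N := N) (i := i) (j := i + 1) (by omega) (by omega)
  have hb := σ_braid (n := N + 1) (i := i) (by omega)
  rw [pureGen, pureGen, descProd_of_lt h]
  generalize descProd N (i + 1) = D at *
  generalize σ i (n := N + 1) _ = a at *
  generalize σ (i + 1) (n := N + 1) _ = b at *
  have h1 : D⁻¹ * a = a * D⁻¹ := by
    rw [inv_mul_eq_iff_eq_mul, ← mul_assoc, ← hD, mul_assoc, mul_inv_cancel, mul_one]
  have h2 : b ^ 2 * a = a * b * a ^ 2 * b⁻¹ := by
    rw [eq_mul_inv_iff_mul_eq]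
    calc b ^ 2 * a * b = b * (b * a * b) := by simp only [pow_two, mul_assoc]
      _ = b * (a * b * a) := by rw [hb]
      _ = (b * a * b) * a := by simp only [mul_assoc]
      _ = a * b * a ^ 2 := by rw [← hb]; simp only [pow_two, mul_assoc]
  calc D * b ^ 2 * D⁻¹ * a = D * (b ^ 2 * a) * D⁻¹ := by simp only [mul_assoc, h1]
    _ = (D * a) * (b * a ^ 2 * b⁻¹ * D⁻¹) := by rw [h2]; simp only [mul_assoc]
    _ = _ := by rw [← hD]; simp only [mul_assoc, mul_inv_rev]

theorem pureGen_self {N i : ℕ} (h : i + 1 < N) :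
    pureGen N i (by omega) * σ i (by omega) =
      σ i (by omega) * (pureGen N i (by omega) * pureGen N (i + 1) h *
        (pureGen N i (by omega))⁻¹) := by
  have hD := descProd_comm (N := N) (i := i) (j := i + 1) (by omega) (by omega)
  have hb := σ_braid (n := N + 1) (i := i) (by omega)
  rw [pureGen, pureGen, descProd_of_lt h]
  generalize descProd N (i + 1) = D at *
  generalize σ i (n := N + 1) _ = a at *
  generalize σ (i + 1) (n := N + 1) _ = b at *
  have h1 : D⁻¹ * a = a * D⁻¹ := by
    rw [inv_mul_eq_iff_eq_mul, ← mul_assoc, ← hD, mul_assoc, mul_inv_cancel, mul_one]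
  have h2 : b * a ^ 2 * b⁻¹ * a = a * (b * a ^ 2 * b * (b * a ^ 2 * b⁻¹)⁻¹) := by
    rw [← mul_assoc, eq_mul_inv_iff_mul_eq]
    have e1 : b⁻¹ * (a * (b * a)) = a * b := by
      rw [inv_mul_eq_iff_eq_mul, ← mul_assoc, hb, mul_assoc]
    have e2 : a * (b * (a * b⁻¹)) = b * a := by
      rw [← mul_assoc, ← mul_assoc, mul_inv_eq_iff_eq_mul, hb]
    have hb' : a * (b * a) = b * (a * b) := by rw [← mul_assoc, hb, mul_assoc]
    calc b * a ^ 2 * b⁻¹ * a * (b * a ^ 2 * b⁻¹)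
        = b * a ^ 2 * (b⁻¹ * (a * (b * a))) * (a * b⁻¹) := by simp only [pow_two, mul_assoc]
      _ = b * a ^ 2 * (a * (b * (a * b⁻¹))) := by rw [e1]; simp only [mul_assoc]
      _ = b * a * (a * (b * a)) := by rw [e2]; simp only [pow_two, mul_assoc]
      _ = (b * (a * b)) * (a * b) := by rw [hb']; simp only [mul_assoc]
      _ = a * (b * a ^ 2 * b) := by rw [← hb']; simp only [pow_two, mul_assoc]
  calc D * b * a ^ 2 * (D * b)⁻¹ * a = D * (b * a ^ 2 * b⁻¹ * a) * D⁻¹ := by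
        simp only [mul_assoc, h1, mul_inv_rev]
    _ = (D * a) * (b * a ^ 2 * b * (b * a ^ 2 * b⁻¹)⁻¹ * D⁻¹) := by rw [h2]; simp only [mul_assoc]
    _ = _ := by rw [← hD]; simp only [pow_two]; group

theorem pureGen_ne {N i j : ℕ} (h : i + 1 < N) (hj : j < N) (h1 : j ≠ i) (h2 : j ≠ i + 1) :
    pureGen N j hj * σ i (by omega) = σ i (by omega) * pureGen N j hj := by
  rw [pureGen]
  rcases lt_or_gt_of_ne h1 with hlt | hgt
  · have e := descProd_shift h hlt
    have c : Commute (σ (n := N + 1) (i + 1) (by omega)) (σ j (by omega)) :=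
      (σ_comm _ _ (by omega)).symm
    have c2 := c.pow_right 2
    have e' : (descProd N j)⁻¹ * σ i (by omega) = σ (i + 1) (by omega) * (descProd N j)⁻¹ := by
      rw [inv_mul_eq_iff_eq_mul, ← mul_assoc, ← e, mul_inv_cancel_right]
    rw [mul_assoc, e', mul_assoc, ← mul_assoc (_ ^ 2), ← c2.eq, mul_assoc, ← mul_assoc,
      ← e]
    simp only [mul_assoc]
  · have e : Commute (σ i _) (descProd N j) := descProd_comm (N := N) (by omega) hgt
    have c : Commute (σ (n := N + 1) i (by omega)) (σ j (by omega)) :=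
      σ_comm _ _ (by omega)
    exact (((e.mul_right (c.pow_right 2)).mul_right e.inv_right).eq).symm

theorem closure_σ (n : ℕ) :
    Subgroup.closure {b : BraidGroup n | ∃ i h, b = σ i h} = ⊤ := by
  rw [← PresentedGroup.closure_range_of]
  congr 1
  ext b
  constructor
  · rintro ⟨i, h, rfl⟩; exact ⟨⟨i, h⟩, rfl⟩
  · rintro ⟨⟨i, h⟩, rfl⟩; exact ⟨i, h, rfl⟩

/-- The homomorphism `F_N ⋊ B_N → B_{N+1}` that is the inclusion on `B_N` and sends `g_i` to
`(σ_{N-1} ⋯ σ_{i+1}) σ_i² (σ_{N-1} ⋯ σ_{i+1})⁻¹`. -/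
def embed (N : ℕ) : FB N →* BraidGroup (N + 1) :=
  SemidirectProduct.lift (FreeGroup.lift fun j : Fin N => pureGen N j.1 j.2) (braidIncl N) (by
    intro b
    have hb : b ∈ Subgroup.closure {b : BraidGroup N | ∃ i h, b = σ i h} := by
      rw [closure_σ]; trivial
    suffices H : ∀ w, FreeGroup.lift (fun j : Fin N => pureGen N j.1 j.2) (artin N b w) =
        braidIncl N b * FreeGroup.lift (fun j : Fin N => pureGen N j.1 j.2) w *
          (braidIncl N b)⁻¹ from MonoidHom.ext H
    induction hb using Subgroup.closure_induction with
    | mem x hx =>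
      obtain ⟨i, h, rfl⟩ := hx
      intro w
      rw [artin_σ, braidIncl_σ]
      suffices H : (FreeGroup.lift (fun j : Fin N => pureGen N j.1 j.2)).comp
          (artinGen i h).toMonoidHom = (MulAut.conj (σ i (by omega))).toMonoidHom.comp
            (FreeGroup.lift (fun j : Fin N => pureGen N j.1 j.2)) from DFunLike.congr_fun H w
      apply FreeGroup.ext_hom
      rintro ⟨j, hj⟩
      simp only [MonoidHom.comp_apply, MulEquiv.coe_toMonoidHom, MulAut.conj_apply,
        FreeGroup.lift_apply_of]
      rw [eq_mul_inv_iff_mul_eq]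
      by_cases h1 : j = i
      · subst h1
        rw [artinGen_self, FreeGroup.lift_apply_of, pureGen_succ]
      by_cases h2 : j = i + 1
      · subst h2
        rw [artinGen_succ]
        simp only [map_mul, map_inv, FreeGroup.lift_apply_of]
        have e1 := pureGen_self h
        have e2 := pureGen_succ h
        have e3 : σ i (by omega) * (pureGen N i (by omega) * pureGen N (i + 1) h *
          (pureGen N i (by omega))⁻¹) = pureGen N (i + 1) h * (σ i (by omega) *
            pureGen N (i + 1) h * (pureGen N i (by omega))⁻¹) := by
          simp only [← mul_assoc, e2]
        rw [e3] at e1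
        rw [mul_assoc, mul_assoc, inv_mul_eq_iff_eq_mul, e2, ← mul_assoc, e1]
        simp only [mul_assoc, inv_mul_cancel, mul_one]
      · rw [artinGen_ne _ _ _ _ h1 h2, FreeGroup.lift_apply_of, pureGen_ne h hj h1 h2]
    | one => simp
    | mul x y _ _ hx hy => intro w; simp [hx, hy, mul_assoc]
    | inv x _ hx =>
      intro w
      have := hx ((artin N x)⁻¹ w)
      simp only [MulAut.apply_inv_self] at this
      rw [this]
      simp [mul_assoc])

/-! ### The universal Long–Moody representation -/

/-- The group ring `ℤ[F_N ⋊ B_N]`. -/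
abbrev GR (N : ℕ) : Type := MonoidAlgebra ℤ (FB N)

/-- A group element, as an element of the group ring. -/
abbrev E {N : ℕ} (x : FB N) : GR N := MonoidAlgebra.of ℤ (FB N) x

/-- The block matrix `diag(I, R_i, I)`, where `R_i = [[0, g_i], [1, 1 - g_i]]` occupies the rows
and columns `i, i + 1`. -/
def blockMat {N : ℕ} (i : ℕ) (h : i + 1 < N) : Matrix (Fin N) (Fin N) (GR N) := fun a b =>
  if a.1 = i then (if b.1 = i + 1 then E (gg i (by omega)) else 0)
  else if a.1 = i + 1 then
    (if b.1 = i then 1 else if b.1 = i + 1 then 1 - E (gg i (by omega)) else 0)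
  else if a = b then 1 else 0

/-- The block matrix `diag(I, R_i⁻¹, I)`, where `R_i⁻¹ = [[1 - g_i⁻¹, 1], [g_i⁻¹, 0]]`. -/
def blockInv {N : ℕ} (i : ℕ) (h : i + 1 < N) : Matrix (Fin N) (Fin N) (GR N) := fun a b =>
  if a.1 = i then
    (if b.1 = i then 1 - E (gg i (by omega))⁻¹ else if b.1 = i + 1 then 1 else 0)
  else if a.1 = i + 1 then (if b.1 = i then E (gg i (by omega))⁻¹ else 0)
  else if a = b then 1 else 0

/-- The row vector with entry `x` in place `a` and zeros elsewhere. -/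
abbrev rowSingle {N : ℕ} {A : Type*} [Ring A] (a : Fin N) (x : A) : Fin N → A := Pi.single a x

theorem rowSingle_add {N : ℕ} {A : Type*} [Ring A] (a : Fin N) (x y : A) :
    rowSingle a (x + y) = rowSingle a x + rowSingle a y := by
  ext b; by_cases h : b = a <;> simp [h]

theorem rowSingle_sub {N : ℕ} {A : Type*} [Ring A] (a : Fin N) (x y : A) :
    rowSingle a (x - y) = rowSingle a x - rowSingle a y := by
  ext b; by_cases h : b = a <;> simp [h]

theorem blockMat_row_self {N : ℕ} (i : ℕ) (h : i + 1 < N) :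
    blockMat i h ⟨i, by omega⟩ = rowSingle ⟨i + 1, h⟩ (E (gg i (by omega))) := by
  ext1 b; simp [blockMat, rowSingle, Pi.single_apply, Fin.ext_iff]

theorem blockMat_row_succ {N : ℕ} (i : ℕ) (h : i + 1 < N) :
    blockMat i h ⟨i + 1, h⟩ =
      rowSingle ⟨i, by omega⟩ 1 + rowSingle ⟨i + 1, h⟩ (1 - E (gg i (by omega))) := by
  ext1 b
  by_cases h1 : b.1 = i <;> simp [blockMat, rowSingle, Pi.single_apply, Fin.ext_iff, h1]

theorem blockMat_row_ne {N : ℕ} (i : ℕ) (h : i + 1 < N) (a : Fin N) (h1 : a.1 ≠ i)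
    (h2 : a.1 ≠ i + 1) : blockMat i h a = rowSingle a 1 := by
  ext1 b; simp [blockMat, rowSingle, Pi.single_apply, h1, h2, eq_comm]

theorem blockInv_row_self {N : ℕ} (i : ℕ) (h : i + 1 < N) :
    blockInv i h ⟨i, by omega⟩ =
      rowSingle ⟨i, by omega⟩ (1 - E (gg i (by omega))⁻¹) + rowSingle ⟨i + 1, h⟩ 1 := by
  ext1 b
  by_cases h1 : b.1 = i <;> simp [blockInv, rowSingle, Pi.single_apply, Fin.ext_iff, h1]

theorem blockInv_row_succ {N : ℕ} (i : ℕ) (h : i + 1 < N) :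
    blockInv i h ⟨i + 1, h⟩ = rowSingle ⟨i, by omega⟩ (E (gg i (by omega))⁻¹) := by
  ext1 b; simp [blockInv, rowSingle, Pi.single_apply, Fin.ext_iff]

theorem blockInv_row_ne {N : ℕ} (i : ℕ) (h : i + 1 < N) (a : Fin N) (h1 : a.1 ≠ i)
    (h2 : a.1 ≠ i + 1) : blockInv i h a = rowSingle a 1 := by
  ext1 b; simp [blockInv, rowSingle, Pi.single_apply, h1, h2, eq_comm]

theorem row_mul {N : ℕ} {A : Type*} [Ring A] (M M' : Matrix (Fin N) (Fin N) A) (a : Fin N) :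
    (M * M') a = Matrix.vecMul (M a) M' := rfl

theorem single_vecMul' {N : ℕ} {A : Type*} [Ring A] (M : Matrix (Fin N) (Fin N) A) (a : Fin N)
    (x : A) : Matrix.vecMul (rowSingle a x) M = fun b => x * M a b := by
  ext b; simp [Matrix.vecMul, dotProduct, rowSingle, Pi.single_apply]

theorem mul_single' {N : ℕ} {A : Type*} [Ring A] (a : Fin N) (x y : A) :
    (fun b => x * rowSingle a y b) = rowSingle a (x * y) := by
  ext b; simp [rowSingle, Pi.single_apply]

theorem mul_add' {N : ℕ} {A : Type*} [Ring A] (x : A) (v w : Fin N → A) :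
    (fun b => x * (v + w) b) = (fun b => x * v b) + fun b => x * w b := by
  ext b; simp [mul_add]

/-- `diag(I, R_i, I)` as an invertible matrix. -/
def blockUnit {N : ℕ} (i : ℕ) (h : i + 1 < N) : (Matrix (Fin N) (Fin N) (GR N))ˣ where
  val := blockMat i h
  inv := blockInv i h
  val_inv := by
    funext a
    rw [row_mul, show (1 : Matrix (Fin N) (Fin N) (GR N)) a = rowSingle a 1 from by
      ext b; simp [Matrix.one_apply, rowSingle, Pi.single_apply, eq_comm]]
    obtain ⟨a, ha⟩ := a
    by_cases h1 : a = i
    · subst h1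
      rw [blockMat_row_self, single_vecMul', blockInv_row_succ, mul_single', ← map_mul]
      simp [MonoidAlgebra.one_def]
    by_cases h2 : a = i + 1
    · subst h2
      rw [blockMat_row_succ, Matrix.add_vecMul, single_vecMul', single_vecMul',
        blockInv_row_succ, blockInv_row_self, mul_single', mul_add', mul_single', mul_single',
        sub_mul, ← map_mul, mul_inv_cancel, add_right_comm, ← rowSingle_add, map_one]
      simp
    · rw [blockMat_row_ne _ _ _ h1 h2, single_vecMul', blockInv_row_ne _ _ _ h1 h2, mul_single']
      simp
  inv_val := by
    funext a
    rw [row_mul, show (1 : Matrix (Fin N) (Fin N) (GR N)) a = rowSingle a 1 from by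
      ext b; simp [Matrix.one_apply, rowSingle, Pi.single_apply, eq_comm]]
    obtain ⟨a, ha⟩ := a
    by_cases h1 : a = i
    · subst h1
      rw [blockInv_row_self, Matrix.add_vecMul, single_vecMul', single_vecMul',
        blockMat_row_succ, blockMat_row_self, mul_single', mul_add', mul_single', mul_single',
        sub_mul, ← map_mul, inv_mul_cancel, add_left_comm, ← rowSingle_add, map_one]
      simp
    by_cases h2 : a = i + 1
    · subst h2
      rw [blockInv_row_succ, single_vecMul', blockMat_row_self, mul_single', ← map_mul]
      simp [MonoidAlgebra.one_def]
    · rw [blockInv_row_ne _ _ _ h1 h2, single_vecMul', blockMat_row_ne _ _ _ h1 h2, mul_single']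
      simp

/-- The scalar matrix of a group element. -/
def scalarUnit {N : ℕ} : FB N →* (Matrix (Fin N) (Fin N) (GR N))ˣ :=
  (Units.map ((Matrix.scalar (Fin N) : GR N →+* _).toMonoidHom.comp
    (MonoidAlgebra.of ℤ (FB N)))).comp (toUnits : FB N ≃* (FB N)ˣ).toMonoidHom

/-- The matrix `σ_i · diag(I, R_i, I)`. -/
def phiGen {N : ℕ} (i : ℕ) (h : i + 1 < N) : (Matrix (Fin N) (Fin N) (GR N))ˣ :=
  scalarUnit (ss i h) * blockUnit i h

theorem phiGen_row {N : ℕ} (i : ℕ) (h : i + 1 < N) (a : Fin N) :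
    (phiGen i h : Matrix (Fin N) (Fin N) (GR N)) a = fun b => E (ss i h) * blockMat i h a b := by
  ext1 b
  simp [phiGen, scalarUnit, blockUnit]

theorem phiGen_row_self {N : ℕ} (i : ℕ) (h : i + 1 < N) :
    (phiGen i h : Matrix (Fin N) (Fin N) (GR N)) ⟨i, by omega⟩ =
      rowSingle ⟨i + 1, h⟩ (E (ss i h) * E (gg i (by omega))) := by
  rw [phiGen_row, blockMat_row_self, mul_single']

theorem phiGen_row_succ {N : ℕ} (i : ℕ) (h : i + 1 < N) :
    (phiGen i h : Matrix (Fin N) (Fin N) (GR N)) ⟨i + 1, h⟩ =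
      rowSingle ⟨i, by omega⟩ (E (ss i h)) +
        rowSingle ⟨i + 1, h⟩ (E (ss i h) * (1 - E (gg i (by omega)))) := by
  rw [phiGen_row, blockMat_row_succ, mul_add', mul_single', mul_single', mul_one]

theorem phiGen_row_ne {N : ℕ} (i : ℕ) (h : i + 1 < N) (a : ℕ) (ha : a < N) (h1 : a ≠ i)
    (h2 : a ≠ i + 1) : (phiGen i h : Matrix (Fin N) (Fin N) (GR N)) ⟨a, ha⟩ =
      rowSingle ⟨a, ha⟩ (E (ss i h)) := by
  rw [phiGen_row, blockMat_row_ne _ _ _ h1 h2, mul_single', mul_one]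

theorem ss_comm {N i j : ℕ} (hi : i + 1 < N) (hj : j + 1 < N) (h : i + 1 < j) :
    ss i hi * ss j hj = ss j hj * ss i hi := by
  simp only [ss, ← map_mul, σ_comm hi hj h]

theorem ss_braid {N i : ℕ} (h : i + 1 + 1 < N) :
    ss i (by omega) * ss (i + 1) h * ss i (by omega) =
      ss (i + 1) h * ss i (by omega) * ss (i + 1) h := by
  simp only [ss, ← map_mul, σ_braid h]

theorem vecMul_single_matrix {N : ℕ} {A : Type*} [Ring A] (M : Matrix (Fin N) (Fin N) A)
    (a b : Fin N) (x y : A) (h : M a = rowSingle b y) :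
    Matrix.vecMul (rowSingle a x) M = rowSingle b (x * y) := by
  rw [single_vecMul', h, mul_single']

theorem vecMul_single_matrix₂ {N : ℕ} {A : Type*} [Ring A] (M : Matrix (Fin N) (Fin N) A)
    (a b c : Fin N) (x y z : A) (h : M a = rowSingle b y + rowSingle c z) :
    Matrix.vecMul (rowSingle a x) M = rowSingle b (x * y) + rowSingle c (x * z) := by
  rw [single_vecMul', h, mul_add', mul_single', mul_single']

theorem phiGen_comm {N i j : ℕ} (hi : i + 1 < N) (hj : j + 1 < N) (h : i + 1 < j) :
    phiGen i hi * phiGen j hj = phiGen j hj * phiGen i hi := by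
  apply Units.ext
  funext a
  obtain ⟨a, ha⟩ := a
  simp only [Units.val_mul, row_mul]
  have n1 := fun a ha h1 h2 x => vecMul_single_matrix _ _ _ x _ (phiGen_row_ne i hi a ha h1 h2)
  have n2 := fun a ha h1 h2 x => vecMul_single_matrix _ _ _ x _ (phiGen_row_ne j hj a ha h1 h2)
  have s1 := fun x => vecMul_single_matrix _ _ _ x _ (phiGen_row_self i hi)
  have s2 := fun x => vecMul_single_matrix _ _ _ x _ (phiGen_row_self j hj)
  have t1 := fun x => vecMul_single_matrix₂ _ _ _ _ x _ _ (phiGen_row_succ i hi)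
  have t2 := fun x => vecMul_single_matrix₂ _ _ _ _ x _ _ (phiGen_row_succ j hj)
  have n11 := n1 j (by omega) (by omega) (by omega)
  have n12 := n1 (j + 1) (by omega) (by omega) (by omega)
  have n21 := n2 i (by omega) (by omega) (by omega)
  have n22 := n2 (i + 1) (by omega) (by omega) (by omega)
  have c0 : E (ss i hi) * E (ss j hj) = E (ss j hj) * E (ss i hi) := by
    rw [← map_mul, ss_comm hi hj h, map_mul]
  have c1 : E (gg i (by omega)) * E (ss j hj) = E (ss j hj) * E (gg i (by omega)) := by
    rw [← map_mul, rel_ne _ _ _ _ (by omega) (by omega), map_mul]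
  have c2 : E (gg j (by omega)) * E (ss i hi) = E (ss i hi) * E (gg j (by omega)) := by
    rw [← map_mul, rel_ne _ _ _ _ (by omega) (by omega), map_mul]
  by_cases d1 : a = i
  · subst d1
    rw [phiGen_row_self, phiGen_row_ne _ _ _ _ (by omega) (by omega), n22, s1,
      mul_assoc, c1, ← mul_assoc, c0, mul_assoc]
  by_cases d2 : a = i + 1
  · subst d2
    rw [phiGen_row_succ, phiGen_row_ne _ _ _ _ (by omega) (by omega), t1, Matrix.add_vecMul,
      n21, n22, mul_assoc, sub_mul, c1, one_mul, ← mul_one_sub, ← mul_assoc, c0, mul_assoc]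
  by_cases d3 : a = j
  · subst d3
    rw [phiGen_row_self, phiGen_row_ne _ _ _ _ (by omega) (by omega), n12, s2,
      mul_assoc, c2, ← mul_assoc, c0, mul_assoc]
  by_cases d4 : a = j + 1
  · subst d4
    rw [phiGen_row_succ, phiGen_row_ne _ _ _ _ (by omega) (by omega), t2, Matrix.add_vecMul,
      n11, n12, mul_assoc, sub_mul, c2, one_mul, ← mul_one_sub, ← mul_assoc, c0, mul_assoc]
  rw [phiGen_row_ne _ _ _ _ d1 d2, phiGen_row_ne _ _ _ _ d3 d4, n1 _ _ d1 d2, n2 _ _ d3 d4, c0]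

theorem phiGen_braid {N i : ℕ} (h : i + 1 + 1 < N) :
    phiGen i (by omega) * phiGen (i + 1) h * phiGen i (by omega) =
      phiGen (i + 1) h * phiGen i (by omega) * phiGen (i + 1) h := by
  apply Units.ext
  funext a
  obtain ⟨a, ha⟩ := a
  simp only [Units.val_mul, row_mul]
  have hi : i + 1 < N := by omega
  have n1 := fun a ha h1 h2 x => vecMul_single_matrix _ _ _ x _ (phiGen_row_ne i hi a ha h1 h2)
  have n2 := fun a ha h1 h2 x =>
    vecMul_single_matrix _ _ _ x _ (phiGen_row_ne (i + 1) h a ha h1 h2)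
  have s1 := fun x => vecMul_single_matrix _ _ _ x _ (phiGen_row_self i hi)
  have s2 := fun x => vecMul_single_matrix _ _ _ x _ (phiGen_row_self (i + 1) h)
  have t1 := fun x => vecMul_single_matrix₂ _ _ _ _ x _ _ (phiGen_row_succ i hi)
  have t2 := fun x => vecMul_single_matrix₂ _ _ _ _ x _ _ (phiGen_row_succ (i + 1) h)
  have n11 := n1 (i + 1 + 1) (by omega) (by omega) (by omega)
  have n22 := n2 i (by omega) (by omega) (by omega)
  have c0 : E (ss i hi) * E (ss (i + 1) h) * E (ss i hi) =
      E (ss (i + 1) h) * E (ss i hi) * E (ss (i + 1) h) := by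
    rw [← map_mul, ← map_mul, ss_braid h, map_mul, map_mul]
  have c1 : E (gg i (by omega)) * E (ss (i + 1) h) =
      E (ss (i + 1) h) * E (gg i (by omega)) := by
    rw [← map_mul, rel_ne _ _ _ _ (by omega) (by omega), map_mul]
  have c2 : E (gg (i + 1) hi) * E (ss i hi) = E (ss i hi) * E (gg i (by omega)) := by
    rw [← map_mul, rel_succ, map_mul]
  have c3 : E (gg i (by omega)) * E (ss i hi) * E (gg i (by omega)) =
      E (ss i hi) * E (gg i (by omega)) * E (gg (i + 1) hi) := by
    rw [← map_mul, ← map_mul, ← map_mul, ← map_mul, rel_self]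
    congr 1
    group
  have p1s := phiGen_row_self i hi
  have p1t := phiGen_row_succ i hi
  have p1n := phiGen_row_ne i hi
  have p2s := phiGen_row_self (i + 1) h
  have p2t := phiGen_row_succ (i + 1) h
  have p2n := phiGen_row_ne (i + 1) h
  generalize E (ss i hi) = s at *
  generalize E (ss (i + 1) h) = u at *
  generalize E (gg i _) = x at *
  generalize E (gg (i + 1) _) = y at *
  have c2' : ∀ z, y * (s * z) = s * (x * z) := fun z => by rw [← mul_assoc, c2, mul_assoc]
  have c1' : ∀ z, x * (u * z) = u * (x * z) := fun z => by rw [← mul_assoc, c1, mul_assoc]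
  have c3' : ∀ z, x * (s * (x * z)) = s * (x * (y * z)) := fun z => by
    rw [← mul_assoc, ← mul_assoc, c3]; simp only [mul_assoc]
  have c0' : ∀ z, s * (u * (s * z)) = u * (s * (u * z)) := fun z => by
    rw [← mul_assoc, ← mul_assoc, c0]; simp only [mul_assoc]
  rw [mul_assoc] at c0 c3
  rw [mul_assoc] at c0 c3
  have e1 := p1n (i + 1 + 1) h (by omega) (by omega)
  have e2 := p2n i (by omega) (by omega) (by omega)
  by_cases d1 : a = i
  · subst d1
    rw [p1s, e2, s2, n11, s1, s2]
    simp only [mul_assoc, c1', c2, c3, c0']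
  by_cases d2 : a = i + 1
  · subst d2
    rw [p1t, p2s, Matrix.add_vecMul, n22, s2, Matrix.add_vecMul, s1, n11, n11, t2]
    simp only [rowSingle_sub, mul_sub, sub_mul, mul_one, mul_assoc, c1, c1', c2, c3,
      c0']
  by_cases d3 : a = i + 1 + 1
  · subst d3
    rw [e1, p2t, t2, Matrix.add_vecMul, Matrix.add_vecMul, t1, t1, n11, n11, Matrix.add_vecMul,
      Matrix.add_vecMul, n22, s2, t2]
    simp only [rowSingle_sub, mul_sub, sub_mul, mul_one, mul_assoc, c1, c1', c2,
      c0, c0']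
    abel
  · rw [p1n a ha d1 d2, p2n a ha d2 d3, n1 _ _ d1 d2, n2 _ _ d2 d3,
      n1 _ _ d1 d2, n2 _ _ d2 d3, mul_assoc, c0, mul_assoc]

/-- The universal Long–Moody representation: the homomorphism from `B_N` to the invertible
`N × N` matrices over `ℤ[F_N ⋊ B_N]` with `σ_i ↦ σ_i · diag(I, R_i, I)`. -/
def phi (N : ℕ) : BraidGroup N →* (Matrix (Fin N) (Fin N) (GR N))ˣ :=
  braidLift (fun i h => phiGen i h) (fun _ _ => phiGen_comm) (fun _ => phiGen_braid)

/-! ### The Long–Moody construction for subgroups of the braid group -/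

/-- `GL(V)`. -/
abbrev GLin (V : Type*) [AddCommGroup V] [Module ℂ V] : Type _ :=
  LinearMap.GeneralLinearGroup ℂ V

/-- The operator `g` applied to the vector `v`. -/
abbrev act {V : Type*} [AddCommGroup V] [Module ℂ V] (x : GLin V) (v : V) : V :=
  (x : V →ₗ[ℂ] V) v

/-- The subgroup `F_N ⋊ G` of `F_N ⋊ B_N`, for `G ≤ B_N`. -/
def FG {N : ℕ} (G : Subgroup (BraidGroup N)) : Subgroup (FB N) :=
  G.comap SemidirectProduct.rightHom

/-- A representation of a group, extended linearly to the integral group ring. -/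
def evalGR {H : Type*} [Group H] {V : Type*} [AddCommGroup V] [Module ℂ V] (ρ : H →* GLin V) :
    MonoidAlgebra ℤ H →ₐ[ℤ] Module.End ℂ V :=
  MonoidAlgebra.lift ℤ (Module.End ℂ V) H ((Units.coeHom (Module.End ℂ V)).comp ρ)

/-- `ρ'` is the Long–Moody representation `ρ⁺ : G → GL(V^{⊕N})` of `ρ : F_N ⋊ G → GL(V)`: for
every `β ∈ G`, all entries of the matrix `phi(β)` lie in the subring `ℤ[F_N ⋊ G]`, and `ρ'(β)` is
the block matrix obtained by applying `ρ` to these entries. -/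
def IsLongMoody {N : ℕ} (G : Subgroup (BraidGroup N)) {V : Type*} [AddCommGroup V] [Module ℂ V]
    (ρ : FG G →* GLin V) (ρ' : G →* GLin (Fin N → V)) : Prop :=
  ∀ (β : G) (i j : Fin N), ∃ a : MonoidAlgebra ℤ (FG G),
    MonoidAlgebra.mapDomain (FG G).subtype a =
      (phi N β : Matrix (Fin N) (Fin N) (GR N)) i j ∧
    ∀ v : V, act (ρ' β) (Pi.single j v) i = evalGR ρ a v

/-- `ρ' : B_{n,m} → GL(V^{⊕(n+m)})` is obtained from `ρ : B_{n,m+1} → GL(V)` by pulling `ρ` back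
along `F_{n+m} ⋊ B_{n,m} → B_{n,m+1}` and applying the Long–Moody construction. -/
def IsLawrenceStep {n m : ℕ} {V : Type*} [AddCommGroup V] [Module ℂ V]
    (ρ : mixedBraid n (m + 1) →* GLin V) (ρ' : mixedBraid n m →* GLin (Fin (n + m) → V)) : Prop :=
  ∃ μ : FG (mixedBraid n m) →* GLin V,
    (∀ x : FG (mixedBraid n m), ∃ h : embed (n + m) x.1 ∈ mixedBraid n (m + 1),
      μ x = ρ ⟨embed (n + m) x.1, h⟩) ∧
    IsLongMoody (mixedBraid n m) μ ρ'

/-! ### Iterating the construction -/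

/-- The identification `(W^{⊕b})^{⊕a} = W^{⊕(ab)}`. -/
def flatten {a b c : ℕ} (h : a * b = c) (W : Type*) [AddCommGroup W] [Module ℂ W] :
    (Fin a → Fin b → W) ≃ₗ[ℂ] (Fin c → W) :=
  (LinearEquiv.curry ℂ W (Fin a) (Fin b)).symm ≪≫ₗ
    LinearEquiv.funCongrLeft ℂ W ((finCongr h.symm).trans finProdFinEquiv.symm)

/-- `τ : B_n → GL(W^{⊕k})`, with `k = n (n + 1) ⋯ (n + m - 1)`, is obtained from
`ρ : B_{n,m} → GL(W)` by applying `IsLawrenceStep` recursively `m` times (`B_{n,0} = B_n`). -/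
def IsIterated.{u} (n : ℕ) : (m : ℕ) → (W : Type u) → [AddCommGroup W] → [Module ℂ W] →
    (mixedBraid n m →* GLin W) →
    (BraidGroup n →* GLin (Fin (∏ j ∈ Finset.range m, (n + j)) → W)) → Prop
  | 0, _, _, _, ρ, τ => ∀ β : BraidGroup n, ∃ h : β ∈ mixedBraid n 0,
      ∀ x i, act (τ β) x i = act (ρ ⟨β, h⟩) (x i)
  | m + 1, W, _, _, ρ, τ =>
      ∃ (ρ' : mixedBraid n m →* GLin (Fin (n + m) → W))
        (τ' : BraidGroup n →* GLin (Fin (∏ j ∈ Finset.range m, (n + j)) → Fin (n + m) → W)),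
        IsLawrenceStep ρ ρ' ∧ IsIterated n m (Fin (n + m) → W) ρ' τ' ∧
        ∀ β x, act (τ β) (flatten (Finset.prod_range_succ _ m).symm W x) =
          flatten (Finset.prod_range_succ _ m).symm W (act (τ' β) x)

/-- `ρ' : B_{n,m} → GL(V)` is the extension of `ρ : B_m → GL(V)` with parameter `q`. In the usual
numbering of the generators from `1`: `ρ'(σ_i) = 1` for `i < n`, `ρ'(σ_n²) = q`, and
`ρ'(σ_{n+i}) = ρ(σ_i)` for `1 ≤ i < m`. (If `n = 0` or `m = 0` there is no `σ_n`.) -/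
structure IsExtension {n m : ℕ} {V : Type*} [AddCommGroup V] [Module ℂ V]
    (ρ : BraidGroup m →* GLin V) (q : ℂˣ) (ρ' : mixedBraid n m →* GLin V) : Prop where
  left : ∀ (i : ℕ) (hi : i + 1 < n),
    ∃ h : (σ i (by omega) : BraidGroup (n + m)) ∈ mixedBraid n m, ρ' ⟨σ i (by omega), h⟩ = 1
  middle : ∀ (i : ℕ) (hi : i + 1 = n) (hm : 0 < m),
    ∃ h : (σ i (by omega) : BraidGroup (n + m)) ^ 2 ∈ mixedBraid n m,
      ∀ v : V, act (ρ' ⟨σ i (by omega) ^ 2, h⟩) v = (q : ℂ) • v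
  right : ∀ (i : ℕ) (hi : i + 1 < m),
    ∃ h : (σ (n + i) (by omega) : BraidGroup (n + m)) ∈ mixedBraid n m,
      ρ' ⟨σ (n + i) (by omega), h⟩ = ρ (σ i hi)

/-- `τ` is the representation `ρ⁺_q` of `B_n` on `V^{⊕k}`, `k = n (n + 1) ⋯ (n + m - 1)`. -/
def IsLawrence {n m : ℕ} {V : Type*} [AddCommGroup V] [Module ℂ V]
    (ρ : BraidGroup m →* GLin V) (q : ℂˣ)
    (τ : BraidGroup n →* GLin (Fin (∏ j ∈ Finset.range m, (n + j)) → V)) : Prop :=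
  ∃ ρ' : mixedBraid n m →* GLin V, IsExtension ρ q ρ' ∧ IsIterated n m V ρ' τ

/-! ### The Lawrence–Krammer representation -/

/-- Pairs `i < j` of positions. -/
abbrev Pairs (n : ℕ) : Type := {p : Fin n × Fin n // p.1 < p.2}

/-- The basis vector `x_{i,j}`, for `i < j < n` (positions numbered from `0`). -/
def pairVec {n : ℕ} (i j : ℕ) : Pairs n → ℂ := fun p => if p.1.1.1 = i ∧ p.1.2.1 = j then 1 else 0

/-- `κ` is the Lawrence–Krammer representation with parameters `q` and `t`, by its standard
matrices on the basis `x_{i,j}`. -/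
def IsLawrenceKrammer {n : ℕ} (q t : ℂˣ) (κ : BraidGroup n →* GLin (Pairs n → ℂ)) : Prop :=
  ∀ (k : ℕ) (hk : k + 1 < n) (i j : ℕ), i < j → j < n →
    act (κ (σ k hk)) (pairVec i j) =
      if k + 1 = i then
        (q : ℂ) • pairVec k j + ((q : ℂ) ^ 2 - q) • pairVec k i + (1 - (q : ℂ)) • pairVec i j
      else if k = i ∧ k + 1 = j then -((t : ℂ) * (q : ℂ) ^ 2) • pairVec i j
      else if k = i then pairVec (i + 1) j
      else if k + 1 = j then
        (q : ℂ) • pairVec i k + (1 - (q : ℂ)) • pairVec i j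
          - (((q : ℂ) ^ 2 - q) * t) • pairVec k j
      else if k = j then pairVec i (j + 1)
      else pairVec i j

end LongMoody

end

open LongMoody

namespace LongMoody

/-! ### Generators of the mixed braid groups -/

/-! Generators are numbered from `0`, as in the definitions.

Part (1) needs existence and uniqueness at two places: the extension of `ρ` to `B_{n,m}`, and the
Long–Moody step. Uniqueness of the extension holds because `B_{n,m}` is generated by the `σ i` with
`i + 1 ≠ n` and by `σ i ^ 2` with `i + 1 = n` (`mixedBraid_le_mixedGens`). This is a
Reidemeister–Schreier argument: the cosets of `B_{n,m}` in `B_{n+m}` are represented by the positive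
braids in which the first `n` strands move right without crossing each other (`Reach`), and all
Schreier generators lie in the subgroup generated by these elements (`Reach.conj_mem`). Existence
avoids a presentation of `B_{n,m}`. A cocycle on all of `B_{n+m}`, for its action on sets of
positions, records the braiding of the strands in the set (through `ρ`) and their linking with the
others (through `q`). A cocycle becomes a homomorphism on the stabilizer of a point, here the set of
the last `m` positions (`exists_isExtension`). A Long–Moody step exists and is unique because the
entries of `phi N b` are combinations of group elements lying over `b` (`phi_mem_grade`), hence come
from unique elements of the group ring of `F_N ⋊ G` whenever `b ∈ G`. Induction on `m` then handles
the iteration.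

For part (2) the extension is a character with `σ k ↦ 1` for `k + 1 < n`, and `F_{n+1} ⋊ B_{n,1}`
acts through it by `g_k ↦ q` for `k < n` and `g_n ↦ t²`. The first step is thus explicit on
`ℂ^{n+1}`, and the vectors `e_i - e_n` with `i < n` span a subspace preserved by the `σ k` with `k +
1 < n` and by the pure braids needed in the second step (`step_pureGen`). In the second step the
vectors `(e_i - e_j) ⊗ ((e_i - e_n) + t (e_j - e_n))` transform by the Lawrence–Krammer formulas
(`forkVec_action`) and are linearly independent (`linearIndependent_forkVec`), so they span the
required subrepresentation. -/

theorem strandPerm_σ {n i : ℕ} (h : i + 1 < n) :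
    strandPerm n (σ i h) = Equiv.swap ⟨i, by omega⟩ ⟨i + 1, h⟩ :=
  braidLift_σ _ _ _ _ _

theorem σ_induction {n : ℕ} {p : BraidGroup n → Prop} (one : p 1)
    (mul : ∀ i h b, p b → p (σ i h * b)) (inv_mul : ∀ i h b, p b → p ((σ i h)⁻¹ * b))
    (b : BraidGroup n) : p b := by
  have hb : b ∈ Subgroup.closure {b : BraidGroup n | ∃ i h, b = σ i h} := by
    rw [closure_σ]; trivial
  induction hb using Subgroup.closure_induction_left with
  | one => exact one
  | mul_left x hx y _ hy => obtain ⟨i, h, rfl⟩ := hx; exact mul i h y hy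
  | inv_mul_cancel x hx y _ hy => obtain ⟨i, h, rfl⟩ := hx; exact inv_mul i h y hy

theorem braid_hom_ext {n : ℕ} {G : Type*} [Group G] {f f' : BraidGroup n →* G}
    (h : ∀ i hi, f (σ i hi) = f' (σ i hi)) : f = f' :=
  PresentedGroup.ext fun i : Gen n => h i.1 i.2

theorem mem_mixedBraid {n m : ℕ} {b : BraidGroup (n + m)} :
    b ∈ mixedBraid n m ↔ ∀ x, (strandPerm (n + m) b x).1 < n ↔ x.1 < n := by
  open Pointwise in
  rw [mixedBraid, Subgroup.mem_comap, MulAction.mem_stabilizer_set]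
  rfl

theorem σ_mem_mixedBraid {n m i : ℕ} (h : i + 1 < n + m) (hi : i + 1 ≠ n) :
    σ i h ∈ mixedBraid n m := by
  rw [mem_mixedBraid]
  intro x
  rw [strandPerm_σ, Equiv.swap_apply_def]
  split_ifs with h1 h2
  · subst h1; simp; omega
  · subst h2; simp; omega
  · rfl

theorem σ_sq_mem_mixedBraid {n m i : ℕ} (h : i + 1 < n + m) : σ i h ^ 2 ∈ mixedBraid n m := by
  rw [mem_mixedBraid]
  intro x
  rw [map_pow, strandPerm_σ, pow_two, Equiv.swap_mul_self]
  rfl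

/-- The standard generators of `B_{n,m}`, as a subgroup of `B_{n+m}`. -/
def mixedGens (n m : ℕ) : Subgroup (BraidGroup (n + m)) :=
  Subgroup.closure ({b | ∃ i h, i + 1 ≠ n ∧ b = σ i h} ∪ {b | ∃ i h, i + 1 = n ∧ b = σ i h ^ 2})

theorem σ_mem_mixedGens {n m i : ℕ} (h : i + 1 < n + m) (hi : i + 1 ≠ n) :
    σ i h ∈ mixedGens n m :=
  Subgroup.subset_closure (Or.inl ⟨i, h, hi, rfl⟩)

theorem σ_sq_mem_mixedGens {n m i : ℕ} (h : i + 1 < n + m) (hi : i + 1 = n) :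
    σ i h ^ 2 ∈ mixedGens n m :=
  Subgroup.subset_closure (Or.inr ⟨i, h, hi, rfl⟩)

/-- The colouring of the positions after exchanging the strands in positions `i` and `i + 1`. -/
def recolor (c : ℕ → Bool) (i : ℕ) : ℕ → Bool := fun x => c (Equiv.swap i (i + 1) x)

theorem recolor_self (c : ℕ → Bool) (i : ℕ) : recolor c i i = c (i + 1) := by simp [recolor]

theorem recolor_succ (c : ℕ → Bool) (i : ℕ) : recolor c i (i + 1) = c i := by simp [recolor]

theorem recolor_ne (c : ℕ → Bool) {i x : ℕ} (h1 : x ≠ i) (h2 : x ≠ i + 1) :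
    recolor c i x = c x := by simp [recolor, Equiv.swap_apply_of_ne_of_ne h1 h2]

theorem recolor_recolor (c : ℕ → Bool) (i : ℕ) : recolor (recolor c i) i = c := by
  ext x; simp [recolor]

theorem recolor_comm (c : ℕ → Bool) {i j : ℕ} (h : i + 1 < j ∨ j + 1 < i) :
    recolor (recolor c i) j = recolor (recolor c j) i := by
  ext x
  simp only [recolor, Equiv.swap_apply_def]
  congr 1
  split_ifs <;> omega

/-- `Reach n m l c b`: the positive braid `b` of length `l` takes the first `n` strands to the
positions of colour `true` under `c`, and no two of these strands cross. -/
inductive Reach (n m : ℕ) : ℕ → (ℕ → Bool) → BraidGroup (n + m) → Prop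
  | base : Reach n m 0 (fun x => decide (x < n)) 1
  | step {l c b} (i : ℕ) (h : i + 1 < n + m) : Reach n m l c b → c i = true →
      c (i + 1) = false → Reach n m (l + 1) (recolor c i) (σ i h * b)

/-- Any exchange visible in the final colouring can be moved to the front of the word. If the first
letter is `σ i` with `i ≠ j`, then `i` is not adjacent to `j`, since the colours left behind by `σ
i` would contradict those at `j` and `j + 1`. So `σ i` commutes past `σ j`. -/
theorem Reach.descent {n m l : ℕ} {c : ℕ → Bool} {b : BraidGroup (n + m)} (hr : Reach n m l c b)
    (j : ℕ) (hj : j + 1 < n + m) (h1 : c j = false) (h2 : c (j + 1) = true) :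
    ∃ l' b', l = l' + 1 ∧ b = σ j hj * b' ∧ Reach n m l' (recolor c j) b' := by
  induction hr with
  | base => simp at h1 h2; omega
  | @step l c b i h hr hi hi' ih =>
    by_cases e : i = j
    · subst e
      exact ⟨l, b, rfl, rfl, by rwa [recolor_recolor]⟩
    by_cases e1 : i = j + 1
    · subst e1
      rw [recolor_self, hi'] at h2; simp at h2
    by_cases e2 : i + 1 = j
    · subst e2
      rw [recolor_succ, hi] at h1; simp at h1
    rw [recolor_ne _ (by omega) (by omega)] at h1 h2
    obtain ⟨l', b', rfl, rfl, hb'⟩ := ih h1 h2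
    refine ⟨l' + 1, σ i h * b', rfl, ?_, ?_⟩
    · rw [← mul_assoc, ← mul_assoc]
      congr 1
      rcases lt_or_gt_of_ne e with e' | e'
      · exact σ_comm _ _ (by omega)
      · exact (σ_comm _ _ (by omega)).symm
    · rw [recolor_comm _ (by omega)]
      exact hb'.step i h (by rw [recolor_ne _ (by omega) (by omega), hi])
        (by rw [recolor_ne _ (by omega) (by omega), hi'])

theorem σ_far {n i j : ℕ} (hi : i + 1 < n) (hj : j + 1 < n) (h : i + 1 < j ∨ j + 1 < i) :
    Commute (σ i hi) (σ j hj) :=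
  h.elim (fun h => σ_comm _ _ h) fun h => (σ_comm _ _ h).symm

theorem conj_of_braid {G : Type*} [Group G] {x y z : G} (h : x * y * x = y * x * y) :
    (x * (y * z))⁻¹ * y * (x * (y * z)) = z⁻¹ * x * z := by
  have : y * x * y = x * y * x := h.symm
  have e : y * (x * (y * z)) = x * (y * (x * z)) := by
    simp only [← mul_assoc, this]
  rw [mul_assoc, e]
  group

theorem conj_sq_of_braid {G : Type*} [Group G] {x y : G} (z : G) (h : x * y * x = y * x * y) :
    (x * z)⁻¹ * y ^ 2 * (x * z) = (z⁻¹ * y * z) * (z⁻¹ * x ^ 2 * z) * (z⁻¹ * y * z)⁻¹ := by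
  have e : x⁻¹ * y * x = y * x * y⁻¹ := by
    rw [eq_mul_inv_iff_mul_eq, mul_assoc, mul_assoc, inv_mul_eq_iff_eq_mul, ← mul_assoc, ← h]
    simp only [mul_assoc]
  calc _ = z⁻¹ * (x⁻¹ * y * x) * (x⁻¹ * y * x) * z := by simp only [pow_two]; group
    _ = _ := by rw [e]; simp only [pow_two]; group

/-- These conjugates are the Schreier generators for the transversal `Reach`. The induction is on
the length: a first letter far from `i` commutes with `σ i` and drops out, and an adjacent one is
removed by the braid relation. -/
theorem Reach.conj_mem {n m l : ℕ} : ∀ {c : ℕ → Bool} {b : BraidGroup (n + m)}, Reach n m l c b →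
    (∀ i h, c i = c (i + 1) → b⁻¹ * σ i h * b ∈ mixedGens n m) ∧
    (∀ i h, c i = true → c (i + 1) = false → b⁻¹ * σ i h ^ 2 * b ∈ mixedGens n m) := by
  induction l using Nat.strong_induction_on with
  | _ l ih =>
  intro c b hr
  cases hr with
  | base =>
    constructor
    · intro i h hi
      simp only [inv_one, one_mul, mul_one]
      refine σ_mem_mixedGens h fun e => ?_
      simp only [decide_eq_decide] at hi
      omega
    · intro i h h1 h2
      simp only [inv_one, one_mul, mul_one]
      simp only [decide_eq_true_eq, decide_eq_false_iff_not] at h1 h2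
      exact σ_sq_mem_mixedGens h (by omega)
  | @step l c b j hj hr hc hc' =>
    obtain ⟨ih1, ih2⟩ := ih l (by omega) hr
    constructor
    · intro i h hi
      by_cases e : i = j
      · subst e; rw [recolor_self, recolor_succ, hc, hc'] at hi; simp at hi
      by_cases e1 : i = j + 1
      · subst e1
        rw [recolor_succ, recolor_ne _ (by omega) (by omega), hc] at hi
        -- The colours at `j`, `j + 1`, `j + 2` were true, false, true before the last exchange. So
        -- the word starts with `σ j σ (j + 1)`, which conjugates `σ (j + 1)` into `σ j`, and two
        -- letters are saved.
        obtain ⟨l', b', rfl, rfl, hb'⟩ := hr.descent (j + 1) h hc' hi.symm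
        rw [conj_of_braid (σ_braid h)]
        exact (ih l' (by omega) hb').1 _ _
          (by rw [recolor_ne _ (by omega) (by omega), recolor_self, hc, ← hi])
      by_cases e2 : j = i + 1
      · subst e2
        rw [recolor_self, recolor_ne _ (by omega) (by omega), hc'] at hi
        obtain ⟨l', b', rfl, rfl, hb'⟩ := hr.descent i h hi hc
        rw [conj_of_braid (σ_braid hj).symm]
        exact (ih l' (by omega) hb').1 _ _
          (by rw [recolor_succ, recolor_ne _ (by omega) (by omega), hi, hc'])
      · rw [recolor_ne _ (by omega) (by omega), recolor_ne _ (by omega) (by omega)] at hi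
        have := ih1 i h hi
        have hcm := σ_far h hj (by omega)
        rwa [mul_assoc, ← mul_assoc (σ i h), hcm.eq, mul_inv_rev, mul_assoc, mul_assoc,
          inv_mul_cancel_left, ← mul_assoc]
    · intro i h h1 h2
      by_cases e : i = j
      · subst e; rw [recolor_self, hc'] at h1; simp at h1
      by_cases e1 : i = j + 1
      · subst e1
        rw [recolor_ne _ (by omega) (by omega)] at h2
        have m1 := ih1 (j + 1) h (by rw [hc', h2])
        have m2 := ih2 j hj hc hc'
        -- Conjugating `σ (j + 1) ^ 2` by `σ j` gives the conjugate of `σ j ^ 2` by `σ (j + 1)`.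
        -- Here `σ (j + 1)` meets two positions of equal colour, so both factors are covered at the
        -- shorter length.
        rw [conj_sq_of_braid _ (σ_braid h)]
        exact mul_mem (mul_mem m1 m2) (inv_mem m1)
      by_cases e2 : j = i + 1
      · subst e2
        rw [recolor_ne _ (by omega) (by omega)] at h1
        have m1 := ih1 i h (by rw [hc, h1])
        have m2 := ih2 (i + 1) hj hc hc'
        rw [conj_sq_of_braid _ (σ_braid hj).symm]
        exact mul_mem (mul_mem m1 m2) (inv_mem m1)
      · rw [recolor_ne _ (by omega) (by omega)] at h1 h2
        have := ih2 i h h1 h2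
        have hcm := (σ_far h hj (by omega)).pow_left 2
        rwa [mul_assoc, ← mul_assoc (σ i h ^ 2), hcm.eq, mul_inv_rev, mul_assoc, mul_assoc,
          inv_mul_cancel_left, ← mul_assoc]

/-- This ties the colouring to the actual permutation, so that membership in `B_{n,m}` can be read
from `c`. -/
theorem Reach.color {n m l : ℕ} {c : ℕ → Bool} {b : BraidGroup (n + m)} (hr : Reach n m l c b)
    (x : Fin (n + m)) : c (strandPerm (n + m) b x) = decide (x.1 < n) := by
  induction hr with
  | base => simp
  | @step l c b i h hr hi hi' ih =>
    rw [map_mul, strandPerm_σ, Equiv.Perm.mul_apply, ← ih]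
    generalize strandPerm (n + m) b x = y
    simp only [recolor]
    congr 1
    simp only [Equiv.swap_apply_def, Fin.ext_iff]
    split_ifs <;> simp_all

/-- The products of a representative and an element of `mixedGens` are stable under left
multiplication by each `σ i` and its inverse. Equal colours at `i` and `i + 1` keep the
representative; unequal colours lengthen or shorten it, at the cost of a conjugate of `σ i ^ 2` in
one of the two directions. -/
theorem exists_reach {n m : ℕ} (b : BraidGroup (n + m)) :
    ∃ l c b' h, Reach n m l c b' ∧ h ∈ mixedGens n m ∧ b = b' * h := by
  induction b using σ_induction with
  | one => exact ⟨_, _, _, 1, .base, one_mem _, by simp⟩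
  | mul i hi b ih =>
    obtain ⟨l, c, b', h, hr, hh, rfl⟩ := ih
    cases h1 : c i <;> cases h2 : c (i + 1)
    · exact ⟨l, c, b', _, hr, mul_mem (hr.conj_mem.1 i hi (h1.trans h2.symm)) hh, by group⟩
    · obtain ⟨l', b'', rfl, rfl, hr'⟩ := hr.descent i hi h1 h2
      refine ⟨_, _, b'', _, hr', mul_mem (hr'.conj_mem.2 i hi ?_ ?_) hh,
        by simp only [pow_two]; group⟩
      · rw [recolor_self, h2]
      · rw [recolor_succ, h1]
    · exact ⟨_, _, _, h, hr.step i hi h1 h2, hh, by group⟩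
    · exact ⟨l, c, b', _, hr, mul_mem (hr.conj_mem.1 i hi (h1.trans h2.symm)) hh, by group⟩
  | inv_mul i hi b ih =>
    obtain ⟨l, c, b', h, hr, hh, rfl⟩ := ih
    cases h1 : c i <;> cases h2 : c (i + 1)
    · exact ⟨l, c, b', _, hr, mul_mem (inv_mem (hr.conj_mem.1 i hi (h1.trans h2.symm))) hh,
        by group⟩
    · obtain ⟨l', b'', rfl, rfl, hr'⟩ := hr.descent i hi h1 h2
      exact ⟨_, _, b'', h, hr', hh, by group⟩
    · exact ⟨_, _, _, _, hr.step i hi h1 h2, mul_mem (inv_mem (hr.conj_mem.2 i hi h1 h2)) hh,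
        by simp only [pow_two]; group⟩
    · exact ⟨l, c, b', _, hr, mul_mem (inv_mem (hr.conj_mem.1 i hi (h1.trans h2.symm))) hh,
        by group⟩

theorem mixedBraid_le_mixedGens (n m : ℕ) : mixedBraid n m ≤ mixedGens n m := by
  intro b hb
  obtain ⟨l, c, b', h, hr, hh, rfl⟩ := exists_reach b
  have hle : mixedGens n m ≤ mixedBraid n m := by
    rw [mixedGens, Subgroup.closure_le]
    rintro _ (⟨i, hi, hne, rfl⟩ | ⟨i, hi, -, rfl⟩)
    · exact σ_mem_mixedBraid hi hne
    · exact σ_sq_mem_mixedBraid hi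
  have hb' : b' ∈ mixedBraid n m := by
    have := mul_mem hb (inv_mem (hle hh))
    rwa [mul_inv_cancel_right] at this
  -- A representative in `B_{n,m}` restores the initial colouring. A nonempty word ends with false
  -- at `i` and true at `i + 1`, which never occurs there, so the representative is `1`.
  have hc : ∀ x, x < n + m → c x = decide (x < n) := by
    intro x hx
    have h1 := hr.color ((strandPerm (n + m) b').symm ⟨x, hx⟩)
    have h2 := mem_mixedBraid.mp hb' ((strandPerm (n + m) b').symm ⟨x, hx⟩)
    rw [Equiv.apply_symm_apply] at h1 h2
    rw [h1, decide_eq_decide, ← h2]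
  cases hr with
  | base => simpa using hh
  | @step l c b i hi hr h1 h2 =>
    have e1 := hc i (by omega)
    have e2 := hc (i + 1) hi
    rw [recolor_self, h2, eq_comm, decide_eq_false_iff_not] at e1
    rw [recolor_succ, h1, eq_comm, decide_eq_true_eq] at e2
    omega

theorem IsExtension.unique {n m : ℕ} {V : Type*} [AddCommGroup V] [Module ℂ V]
    {ρ : BraidGroup m →* GLin V} {q : ℂˣ} {f f' : mixedBraid n m →* GLin V}
    (hf : IsExtension ρ q f) (hf' : IsExtension ρ q f') : f = f' := by
  -- The locus where the two extensions agree is a subgroup of `B_{n,m}`; its image in `B_{n+m}`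
  -- contains all the generators.
  have hle : mixedGens n m ≤ (f.eqLocus f').map (mixedBraid n m).subtype := by
    rw [mixedGens, Subgroup.closure_le]
    rintro _ (⟨i, hi, hne, rfl⟩ | ⟨i, hi, he, rfl⟩)
    · refine ⟨⟨σ i hi, σ_mem_mixedBraid hi hne⟩, ?_, rfl⟩
      rcases lt_or_gt_of_ne hne with hlt | hgt
      · exact (hf.left i hlt).2.trans (hf'.left i hlt).2.symm
      · obtain ⟨j, rfl⟩ := Nat.exists_eq_add_of_le (Nat.lt_succ_iff.mp hgt)
        exact (hf.right j (by omega)).2.trans (hf'.right j (by omega)).2.symm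
    · refine ⟨⟨σ i hi ^ 2, σ_sq_mem_mixedBraid hi⟩, ?_, rfl⟩
      refine Units.ext (LinearMap.ext fun v => ?_)
      exact ((hf.middle i he (by omega)).2 v).trans ((hf'.middle i he (by omega)).2 v).symm
  ext1 b
  obtain ⟨b', hb', e⟩ := hle (mixedBraid_le_mixedGens n m b.2)
  rw [← Subtype.ext e]
  exact hb'

/-! ### Extending a representation of `B_m` to `B_{n,m}` -/

/-- The number of elements of `S` below `k`. -/
def below {N : ℕ} (S : Finset (Fin N)) (k : ℕ) : ℕ := (S.filter fun x => x.1 < k).card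

theorem below_succ {N : ℕ} (S : Finset (Fin N)) (k : ℕ) (h : k < N) :
    below S (k + 1) = below S k + if (⟨k, h⟩ : Fin N) ∈ S then 1 else 0 := by
  have e : (S.filter fun x => x.1 < k + 1) =
      (S.filter fun x => x.1 < k) ∪ S.filter fun x => x = ⟨k, h⟩ := by
    ext x
    simp only [Finset.mem_filter, Finset.mem_union, Fin.ext_iff, ← and_or_left]
    exact and_congr_right fun _ => Nat.lt_succ_iff_lt_or_eq
  rw [below, e, Finset.card_union_of_disjoint, below, Finset.filter_eq']
  · split_ifs <;> simp
  · rw [Finset.disjoint_left]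
    intro x hx hx'
    simp only [Finset.mem_filter, Fin.ext_iff] at hx hx'
    omega

theorem below_mono {N : ℕ} (S : Finset (Fin N)) {k l : ℕ} (h : k ≤ l) : below S k ≤ below S l :=
  Finset.card_le_card (Finset.monotone_filter_right S fun _ _ hx => lt_of_lt_of_le hx h)

theorem below_le_card {N : ℕ} (S : Finset (Fin N)) (k : ℕ) : below S k ≤ S.card :=
  Finset.card_filter_le _ _

/-- The transposition of the positions `i` and `i + 1`. -/
abbrev sw {N : ℕ} (i : ℕ) (h : i + 1 < N) : Equiv.Perm (Fin N) :=
  Equiv.swap ⟨i, by omega⟩ ⟨i + 1, h⟩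

open Pointwise in
theorem mem_sw_smul {N : ℕ} {i : ℕ} (h : i + 1 < N) (S : Finset (Fin N)) (x : Fin N) :
    x ∈ sw i h • S ↔ sw i h x ∈ S := by
  rw [← Finset.inv_smul_mem_iff]; simp [sw, Equiv.Perm.smul_def]

open Pointwise in
theorem self_mem_sw_smul {N : ℕ} {i : ℕ} (h : i + 1 < N) (S : Finset (Fin N)) (h' : i < N) :
    (⟨i, h'⟩ : Fin N) ∈ sw i h • S ↔ (⟨i + 1, h⟩ : Fin N) ∈ S := by
  rw [mem_sw_smul, Equiv.swap_apply_left]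

open Pointwise in
theorem succ_mem_sw_smul {N : ℕ} {i : ℕ} (h : i + 1 < N) (S : Finset (Fin N)) :
    (⟨i + 1, h⟩ : Fin N) ∈ sw i h • S ↔ (⟨i, by omega⟩ : Fin N) ∈ S := by
  rw [mem_sw_smul, Equiv.swap_apply_right]

open Pointwise in
theorem ne_mem_sw_smul {N : ℕ} {i : ℕ} (h : i + 1 < N) (S : Finset (Fin N)) {k : ℕ} (h' : k < N)
    (h1 : k ≠ i) (h2 : k ≠ i + 1) :
    (⟨k, h'⟩ : Fin N) ∈ sw i h • S ↔ (⟨k, h'⟩ : Fin N) ∈ S := by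
  rw [mem_sw_smul, Equiv.swap_apply_of_ne_of_ne] <;> simpa [Fin.ext_iff]

open Pointwise in
-- Only the cut at `i + 1` separates the positions `i` and `i + 1`.
theorem below_sw_smul {N : ℕ} {i : ℕ} (h : i + 1 < N) (S : Finset (Fin N)) {k : ℕ}
    (hk : k ≠ i + 1) : below (sw i h • S) k = below S k := by
  rw [below, below, ← Finset.card_smul_finset (sw i h) (S.filter _)]
  congr 1
  ext x
  simp only [Finset.mem_filter, mem_sw_smul]
  refine and_congr_right fun _ => ?_
  simp only [sw, Equiv.swap_apply_def, Fin.ext_iff]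
  split_ifs with h1 h2 <;> simp only <;> omega

section Cocycle

variable {G : Type*} [Group G]

/-- The value at a generator of the cocycle that records how the `m` strands whose positions
form the set `S` braid among themselves (by `w`) and link with the other strands (by `q`). -/
def linkCocycle (w : ℕ → G) (q : G) (m : ℕ) {N : ℕ} (i : ℕ) (h : i + 1 < N)
    (S : Finset (Fin N)) : G :=
  if S.card = m then
    if (⟨i, by omega⟩ : Fin N) ∈ S then
      if (⟨i + 1, h⟩ : Fin N) ∈ S then w (below S i) else q
    else 1
  else 1

open Pointwise in
-- Distant exchanges do not affect each other's values. If both braid strands of `S`, the ranks of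
-- these strands in `S` differ by at least two, so the two values of `w` commute.
theorem linkCocycle_comm {w : ℕ → G} {q : G} {m : ℕ} (hq : ∀ x, q * x = x * q)
    (hw : ∀ r s, r + 1 < s → w r * w s = w s * w r) {N i j : ℕ} (hi : i + 1 < N)
    (hj : j + 1 < N) (h : i + 1 < j) (S : Finset (Fin N)) :
    linkCocycle w q m i hi S * linkCocycle w q m j hj (sw i hi • S) =
      linkCocycle w q m j hj S * linkCocycle w q m i hi (sw j hj • S) := by
  simp only [linkCocycle, Finset.card_smul_finset]
  by_cases hc : S.card = m
  swap
  · simp [hc]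
  simp only [if_pos hc, below_sw_smul hi S (k := j) (by omega),
    below_sw_smul hj S (k := i) (by omega),
    ne_mem_sw_smul hi S (k := j) (by omega) (by omega) (by omega),
    ne_mem_sw_smul hi S (k := j + 1) (by omega) (by omega) (by omega),
    ne_mem_sw_smul hj S (k := i) (by omega) (by omega) (by omega),
    ne_mem_sw_smul hj S (k := i + 1) (by omega) (by omega) (by omega)]
  split_ifs with h1 h2 h3 h4 h4
  all_goals try simp only [mul_one, one_mul, hq]
  apply hw
  have e1 := below_succ S i (by omega)
  have e2 := below_succ S (i + 1) (by omega)
  rw [if_pos h1] at e1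
  rw [if_pos h2] at e2
  have := below_mono S (k := i + 1 + 1) (l := j) (by omega)
  omega

open Pointwise in
-- The proof distinguishes which of the three positions lie in `S`. With all three, this is the
-- braid relation for `w`. Otherwise at most one value of `w` occurs on each side; it has the same
-- index on both, because ranks count only strands of `S`, and the central factors `q` agree in
-- number.
theorem linkCocycle_braid {w : ℕ → G} {q : G} {m : ℕ} (hq : ∀ x, q * x = x * q)
    (hw : ∀ r, r + 1 + 1 < m → w r * w (r + 1) * w r = w (r + 1) * w r * w (r + 1)) {N i : ℕ}
    (h : i + 1 + 1 < N) (hi : i + 1 < N) (S : Finset (Fin N)) :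
    linkCocycle w q m i hi S * linkCocycle w q m (i + 1) h (sw i hi • S) *
        linkCocycle w q m i hi (sw (i + 1) h • sw i hi • S) =
      linkCocycle w q m (i + 1) h S * linkCocycle w q m i hi (sw (i + 1) h • S) *
        linkCocycle w q m (i + 1) h (sw i hi • sw (i + 1) h • S) := by
  simp only [linkCocycle, Finset.card_smul_finset]
  by_cases hc : S.card = m
  swap
  · simp [hc]
  have a1 := fun T => self_mem_sw_smul hi T (by omega)
  have a2 := fun T => succ_mem_sw_smul hi T
  have a3 := fun T => ne_mem_sw_smul hi T (k := i + 1 + 1) h (by omega) (by omega)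
  have b1 := fun T => self_mem_sw_smul h T hi
  have b2 := fun T => succ_mem_sw_smul h T
  have b3 := fun T => ne_mem_sw_smul h T (k := i) (by omega) (by omega) (by omega)
  have c1 := fun T => below_sw_smul hi T (k := i) (by omega)
  have c2 := fun T => below_sw_smul h T (k := i) (by omega)
  have c3 := fun T : Finset (Fin N) => below_succ T i (by omega)
  have c4 := below_succ S (i + 1) (by omega)
  have c5 := below_succ S (i + 1 + 1) (by omega)
  -- With three consecutive positions in a set of size `m`, the rank `r` of the first satisfies `r +
  -- 2 < m`, as `hw'` requires. This is why the cocycle is trivial on sets of other sizes.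
  have c6 := below_le_card S (i + 1 + 1 + 1)
  simp only [if_pos hc, a1, a2, a3, b1, b2, b3, c1, c2, c3]
  simp only [c3] at c4
  by_cases d1 : (⟨i, by omega⟩ : Fin N) ∈ S <;> by_cases d2 : (⟨i + 1, hi⟩ : Fin N) ∈ S <;>
    by_cases d3 : (⟨i + 1 + 1, h⟩ : Fin N) ∈ S <;>
    simp only [d1, d2, d3, if_true, if_false, mul_one, one_mul, add_zero, hq] at c4 c5 ⊢
  · exact hw _ (by omega)
  all_goals simp only [mul_assoc, hq]

open Pointwise in
theorem mulAutArrow_apply_finset {N : ℕ} (π : Equiv.Perm (Fin N)) (f : Finset (Fin N) → G)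
    (S : Finset (Fin N)) : mulAutArrow π f S = f (π⁻¹ • S) := rfl

open Pointwise in
/-- The action of the braid group on the positions of a set of strands, together with the
cocycle `linkCocycle`. -/
def linkHom {w : ℕ → G} {q : G} {m : ℕ} (hq : ∀ x, q * x = x * q)
    (hw : ∀ r s, r + 1 < s → w r * w s = w s * w r)
    (hw' : ∀ r, r + 1 + 1 < m → w r * w (r + 1) * w r = w (r + 1) * w r * w (r + 1)) (N : ℕ) :
    BraidGroup N →* (Finset (Fin N) → G) ⋊[mulAutArrow] Equiv.Perm (Fin N) :=
  braidLift (fun i h => ⟨linkCocycle w q m i h, sw i h⟩)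
    (by
      intro i j hi hj h
      refine SemidirectProduct.ext ?_ ?_
      · funext S
        simp only [SemidirectProduct.mul_left, Pi.mul_apply, mulAutArrow_apply_finset,
          Equiv.swap_inv]
        exact linkCocycle_comm hq hw hi hj h S
      · have := congrArg (strandPerm N) (σ_comm hi hj h)
        rwa [map_mul, map_mul, strandPerm_σ, strandPerm_σ] at this)
    (by
      intro i h
      refine SemidirectProduct.ext ?_ ?_
      · funext S
        simp only [SemidirectProduct.mul_left, SemidirectProduct.mul_right, Pi.mul_apply,
          mulAutArrow_apply_finset, mul_inv_rev, Equiv.swap_inv, mul_smul]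
        exact linkCocycle_braid hq hw' h (by omega) S
      · have := congrArg (strandPerm N) (σ_braid h)
        simp only [map_mul, strandPerm_σ] at this
        exact this)

open Pointwise in
theorem linkHom_σ {w : ℕ → G} {q : G} {m : ℕ} (hq : ∀ x, q * x = x * q)
    (hw : ∀ r s, r + 1 < s → w r * w s = w s * w r)
    (hw' : ∀ r, r + 1 + 1 < m → w r * w (r + 1) * w r = w (r + 1) * w r * w (r + 1)) {N i : ℕ}
    (h : i + 1 < N) : linkHom hq hw hw' N (σ i h) = ⟨linkCocycle w q m i h, sw i h⟩ :=
  braidLift_σ _ _ _ _ _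

open Pointwise in
theorem linkHom_right {w : ℕ → G} {q : G} {m : ℕ} (hq : ∀ x, q * x = x * q)
    (hw : ∀ r s, r + 1 < s → w r * w s = w s * w r)
    (hw' : ∀ r, r + 1 + 1 < m → w r * w (r + 1) * w r = w (r + 1) * w r * w (r + 1)) {N : ℕ}
    (b : BraidGroup N) : (linkHom hq hw hw' N b).right = strandPerm N b := by
  have : SemidirectProduct.rightHom.comp (linkHom hq hw hw' N) = strandPerm N := by
    refine braid_hom_ext fun i hi => ?_
    rw [MonoidHom.comp_apply, linkHom_σ, strandPerm_σ]
    rfl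
  exact DFunLike.congr_fun this b

end Cocycle

/-- The positions of the last `m` of `n + m` strands. -/
def lastPos (n m : ℕ) : Finset (Fin (n + m)) := Finset.univ.filter fun x => n ≤ x.1

theorem mem_lastPos {n m : ℕ} {x : Fin (n + m)} : x ∈ lastPos n m ↔ n ≤ x.1 := by
  simp [lastPos]

theorem below_lastPos (n m : ℕ) {i : ℕ} (h : i ≤ m) : below (lastPos n m) (n + i) = i := by
  induction i with
  | zero =>
    rw [below, Finset.card_eq_zero, Finset.filter_eq_empty_iff]
    intro x hx
    rw [mem_lastPos] at hx
    omega
  | succ i ih =>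
    rw [← add_assoc, below_succ _ _ (by omega), ih (by omega), if_pos (by simp [mem_lastPos])]

theorem card_lastPos (n m : ℕ) : (lastPos n m).card = m := by
  have h := below_lastPos n m le_rfl
  rwa [below, Finset.filter_true_of_mem fun x _ => x.2] at h

open Pointwise in
theorem smul_lastPos {n m : ℕ} {b : BraidGroup (n + m)} (hb : b ∈ mixedBraid n m) :
    strandPerm (n + m) b • lastPos n m = lastPos n m := by
  ext x
  rw [← Finset.inv_smul_mem_iff, mem_lastPos, mem_lastPos]
  have h := mem_mixedBraid.mp (inv_mem hb) x
  rw [map_inv] at h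
  rw [Equiv.Perm.smul_def]
  omega

/-- A cocycle for the action on positions restricts to a homomorphism on `B_{n,m}`. -/
def linkRestrict {G : Type*} [Group G] {w : ℕ → G} {q : G} {m : ℕ} (hq : ∀ x, q * x = x * q)
    (hw : ∀ r s, r + 1 < s → w r * w s = w s * w r)
    (hw' : ∀ r, r + 1 + 1 < m → w r * w (r + 1) * w r = w (r + 1) * w r * w (r + 1)) (n : ℕ) :
    mixedBraid n m →* G where
  toFun b := (linkHom hq hw hw' (n + m) b).left (lastPos n m)
  map_one' := by simp
  map_mul' a b := by
    -- The second factor is evaluated at the translate of `lastPos n m` under the inverse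
    -- permutation of `a`, which is `lastPos n m` itself.
    rw [Subgroup.coe_mul, map_mul, SemidirectProduct.mul_left, Pi.mul_apply,
      mulAutArrow_apply_finset, linkHom_right, ← map_inv, smul_lastPos (inv_mem a.2)]

open Pointwise in
theorem exists_isExtension {V : Type*} [AddCommGroup V] [Module ℂ V] (n : ℕ) {m : ℕ}
    (ρ : BraidGroup m →* GLin V) (q : ℂˣ) : ∃ ρ' : mixedBraid n m →* GLin V,
      IsExtension ρ q ρ' := by
  -- The padding by `1` preserves the commutation relations for all indices; the braid relation is
  -- only required in the range where no padding occurs.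
  let w : ℕ → GLin V := fun r => if h : r + 1 < m then ρ (σ r h) else 1
  let q' : GLin V := Units.map (algebraMap ℂ (Module.End ℂ V)).toMonoidHom q
  have hq : ∀ x, q' * x = x * q' := fun x => Units.ext (Algebra.commutes _ _)
  have hw : ∀ r s, r + 1 < s → w r * w s = w s * w r := by
    intro r s h
    simp only [w]
    split_ifs
    · rw [← map_mul, ← map_mul, σ_comm _ _ h]
    all_goals simp
  have hw' : ∀ r, r + 1 + 1 < m → w r * w (r + 1) * w r = w (r + 1) * w r * w (r + 1) := by
    intro r h
    simp only [w, dif_pos h, dif_pos (show r + 1 < m by omega), ← map_mul, σ_braid h]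
  have hv : ∀ i (h : i + 1 < n + m), (linkHom hq hw hw' (n + m) (σ i h)).left (lastPos n m) =
      if n ≤ i then w (i - n) else 1 := by
    intro i h
    rw [linkHom_σ]
    simp only [linkCocycle, card_lastPos, if_true, mem_lastPos]
    split_ifs with h1 h2
    · obtain ⟨j, rfl⟩ := Nat.exists_eq_add_of_le h1
      rw [below_lastPos _ _ (by omega), Nat.add_sub_cancel_left]
    · omega
    · rfl
  refine ⟨linkRestrict hq hw hw' n, ?_, ?_, ?_⟩
  · intro i hi
    exact ⟨σ_mem_mixedBraid _ hi.ne, (hv i _).trans (if_neg (by omega))⟩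
  · intro i hi hm
    refine ⟨σ_sq_mem_mixedBraid _, fun v => ?_⟩
    -- Of the two crossings in `σ i ^ 2`, the one evaluated at `lastPos` contributes `1` and the one
    -- evaluated after the exchange contributes `q`.
    have e : linkRestrict hq hw hw' n ⟨σ i (by omega) ^ 2, σ_sq_mem_mixedBraid _⟩ = q' := by
      change (linkHom hq hw hw' (n + m) (σ i _ ^ 2)).left (lastPos n m) = q'
      rw [pow_two, map_mul, SemidirectProduct.mul_left, Pi.mul_apply, hv, if_neg (by omega),
        mulAutArrow_apply_finset, linkHom_σ, one_mul]
      change linkCocycle w q' m i _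
        ((sw i (by omega) : Equiv.Perm (Fin (n + m)))⁻¹ • lastPos n m) = q'
      rw [Equiv.swap_inv, linkCocycle, if_pos, if_pos, if_neg]
      · rw [succ_mem_sw_smul, mem_lastPos]; simp only; omega
      · rw [self_mem_sw_smul, mem_lastPos]; simp only; omega
      · rw [Finset.card_smul_finset, card_lastPos]
    rw [e]
    rfl
  · intro i hi
    refine ⟨σ_mem_mixedBraid _ (by omega), (hv _ _).trans ?_⟩
    rw [if_pos (by omega), Nat.add_sub_cancel_left]
    exact dif_pos hi

/-! ### The Long–Moody representation -/

/-- The part of `ℤ[F_N ⋊ B_N]` spanned by the group elements with image `b` in `B_N`. -/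
noncomputable def grade {N : ℕ} (b : BraidGroup N) : AddSubgroup (GR N) :=
  AddSubgroup.closure (E '' {x | x.right = b})

theorem E_mem_grade {N : ℕ} {x : FB N} {b : BraidGroup N} (h : x.right = b) : E x ∈ grade b :=
  AddSubgroup.subset_closure ⟨x, h, rfl⟩

theorem one_mem_grade {N : ℕ} : (1 : GR N) ∈ grade 1 := by
  rw [← map_one (MonoidAlgebra.of ℤ (FB N))]
  exact E_mem_grade rfl

theorem mul_mem_grade {N : ℕ} {b c : BraidGroup N} {y z : GR N} (hy : y ∈ grade b)
    (hz : z ∈ grade c) : y * z ∈ grade (b * c) := by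
  induction hy using AddSubgroup.closure_induction with
  | mem y hy =>
    obtain ⟨y, rfl, rfl⟩ := hy
    induction hz using AddSubgroup.closure_induction with
    | mem z hz =>
      obtain ⟨z, rfl, rfl⟩ := hz
      rw [← map_mul]
      exact E_mem_grade rfl
    | zero => rw [mul_zero]; exact zero_mem _
    | add z z' _ _ h h' => rw [mul_add]; exact add_mem h h'
    | neg z _ h => rw [mul_neg]; exact neg_mem h
  | zero => rw [zero_mul]; exact zero_mem _
  | add y y' _ _ h h' => rw [add_mul]; exact add_mem h h'
  | neg y _ h => rw [neg_mul]; exact neg_mem h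

/-- The inclusion `ℤ[F_N ⋊ G] → ℤ[F_N ⋊ B_N]`. -/
noncomputable abbrev inclGR {N : ℕ} (G : Subgroup (BraidGroup N)) : MonoidAlgebra ℤ (FG G) →+* GR N :=
  MonoidAlgebra.mapDomainRingHom ℤ (FG G).subtype

theorem inclGR_injective {N : ℕ} (G : Subgroup (BraidGroup N)) :
    Function.Injective (inclGR G) :=
  MonoidAlgebra.mapDomain_injective Subtype.val_injective

theorem inclGR_of {N : ℕ} (G : Subgroup (BraidGroup N)) (x : FG G) :
    inclGR G (MonoidAlgebra.of ℤ (FG G) x) = E x.1 := by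
  simp [inclGR]

theorem mem_range_inclGR {N : ℕ} {G : Subgroup (BraidGroup N)} {b : BraidGroup N} (hb : b ∈ G)
    {y : GR N} (hy : y ∈ grade b) : y ∈ (inclGR G).range := by
  induction hy using AddSubgroup.closure_induction with
  | mem y hy =>
    obtain ⟨y, rfl, rfl⟩ := hy
    exact ⟨MonoidAlgebra.of ℤ (FG G) ⟨y, hb⟩, inclGR_of G _⟩
  | zero => exact zero_mem _
  | add y y' _ _ h h' => exact add_mem h h'
  | neg y _ h => exact neg_mem h

theorem blockMat_mem_grade {N i : ℕ} (h : i + 1 < N) (a b : Fin N) :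
    blockMat i h a b ∈ grade 1 := by
  unfold blockMat
  split_ifs
  · exact E_mem_grade rfl
  · exact zero_mem _
  · exact one_mem_grade
  · exact sub_mem one_mem_grade (E_mem_grade rfl)
  · exact zero_mem _
  · exact one_mem_grade
  · exact zero_mem _

theorem blockInv_mem_grade {N i : ℕ} (h : i + 1 < N) (a b : Fin N) :
    blockInv i h a b ∈ grade 1 := by
  unfold blockInv
  split_ifs
  · refine sub_mem one_mem_grade (E_mem_grade ?_)
    simp [gg]
  · exact one_mem_grade
  · exact zero_mem _
  · refine E_mem_grade ?_
    simp [gg]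
  · exact zero_mem _
  · exact one_mem_grade
  · exact zero_mem _

theorem matrix_mul_mem_grade {N : ℕ} {b c : BraidGroup N} {M M' : Matrix (Fin N) (Fin N) (GR N)}
    (h : ∀ i j, M i j ∈ grade b) (h' : ∀ i j, M' i j ∈ grade c) (i j : Fin N) :
    (M * M') i j ∈ grade (b * c) := by
  rw [Matrix.mul_apply]
  exact sum_mem fun k _ => mul_mem_grade (h i k) (h' k j)

theorem scalarUnit_mem_grade {N : ℕ} (x : FB N) (i j : Fin N) :
    (scalarUnit x : Matrix (Fin N) (Fin N) (GR N)) i j ∈ grade x.right := by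
  change Matrix.scalar (Fin N) (E x) i j ∈ _
  rw [Matrix.scalar_apply, Matrix.diagonal_apply]
  split_ifs
  · exact E_mem_grade rfl
  · exact zero_mem _

theorem phi_σ {N i : ℕ} (h : i + 1 < N) : phi N (σ i h) = phiGen i h := braidLift_σ _ _ _ _ _

/-- The group ring is graded by `B_N`. The blocks `R_i` and their inverses are homogeneous of degree
`1` and the scalar matrix of `σ_i` of degree `σ_i`, so the degree of a product is the braid itself.
-/
theorem phi_mem_grade {N : ℕ} (b : BraidGroup N) (i j : Fin N) :
    (phi N b : Matrix (Fin N) (Fin N) (GR N)) i j ∈ grade b := by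
  induction b using σ_induction generalizing i j with
  | one =>
    rw [map_one, Units.val_one, Matrix.one_apply]
    split_ifs
    · exact one_mem_grade
    · exact zero_mem _
  | mul k h b ih =>
    rw [map_mul, Units.val_mul, phi_σ, phiGen, Units.val_mul]
    refine matrix_mul_mem_grade (fun i j => ?_) ih i j
    have := matrix_mul_mem_grade (scalarUnit_mem_grade (ss k h)) (blockMat_mem_grade h) i j
    rwa [mul_one] at this
  | inv_mul k h b ih =>
    rw [map_mul, Units.val_mul, map_inv, phi_σ, phiGen, mul_inv_rev, Units.val_mul, ← map_inv]
    refine matrix_mul_mem_grade (fun i j => ?_) ih i j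
    have := matrix_mul_mem_grade (blockInv_mem_grade h) (scalarUnit_mem_grade (ss k h)⁻¹) i j
    rwa [one_mul] at this

section LongMoodyRep

variable {N : ℕ} {G : Subgroup (BraidGroup N)} {V : Type*} [AddCommGroup V] [Module ℂ V]

theorem exists_phi_restrict (b : G) :
    ∃ A : Matrix (Fin N) (Fin N) (MonoidAlgebra ℤ (FG G)), (inclGR G).mapMatrix A = phi N b := by
  choose A hA using fun i j => mem_range_inclGR b.2 (phi_mem_grade b.1 i j)
  exact ⟨A, Matrix.ext hA⟩

/-- The universal Long–Moody representation of `G`, with matrices over `ℤ[F_N ⋊ G]`. -/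
noncomputable def phiRestrict (G : Subgroup (BraidGroup N)) :
    G →* Matrix (Fin N) (Fin N) (MonoidAlgebra ℤ (FG G)) where
  toFun b := (exists_phi_restrict b).choose
  map_one' := by
    -- The lifts were chosen separately for each braid; injectivity of the inclusion of group rings
    -- makes them multiplicative.
    apply Matrix.map_injective (inclGR_injective G)
    change (inclGR G).mapMatrix _ = (inclGR G).mapMatrix _
    rw [(exists_phi_restrict (1 : G)).choose_spec, map_one, Subgroup.coe_one, map_one,
      Units.val_one]
  map_mul' b c := by
    apply Matrix.map_injective (inclGR_injective G)
    change (inclGR G).mapMatrix _ = (inclGR G).mapMatrix _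
    rw [map_mul, (exists_phi_restrict _).choose_spec, (exists_phi_restrict _).choose_spec,
      (exists_phi_restrict _).choose_spec, Subgroup.coe_mul, map_mul, Units.val_mul]

theorem inclGR_phiRestrict (b : G) (i j : Fin N) :
    inclGR G (phiRestrict G b i j) = (phi N b : Matrix (Fin N) (Fin N) (GR N)) i j :=
  congrFun (congrFun (exists_phi_restrict b).choose_spec i) j

theorem exists_isLongMoody (μ : FG G →* GLin V) :
    ∃ ρ' : G →* GLin (Fin N → V), IsLongMoody G μ ρ' := by
  let f : G →* Module.End ℂ (Fin N → V) :=
    (((endVecRingEquivMatrixEnd (Fin N) ℂ V).symm : _ →+* _).toMonoidHom.comp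
      ((evalGR μ : _ →+* Module.End ℂ V).mapMatrix.toMonoidHom)).comp (phiRestrict G)
  refine ⟨f.toHomUnits, fun b i j => ⟨phiRestrict G b i j, inclGR_phiRestrict b i j, fun v => ?_⟩⟩
  change ∑ k, evalGR μ (phiRestrict G b i k) ((Pi.single j v : Fin N → V) k) = _
  rw [Finset.sum_eq_single j]
  · rw [Pi.single_eq_same]
  · intro k _ hk
    rw [Pi.single_eq_of_ne hk, map_zero]
  · simp

/-- The witness in `IsLongMoody` is determined by injectivity of the inclusion of group rings, so
any lift of the entry may be used. -/
theorem IsLongMoody.apply {μ : FG G →* GLin V} {ρ' : G →* GLin (Fin N → V)}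
    (h : IsLongMoody G μ ρ') (b : G) (i j : Fin N) (a : MonoidAlgebra ℤ (FG G))
    (ha : inclGR G a = (phi N b : Matrix (Fin N) (Fin N) (GR N)) i j) (v : V) :
    act (ρ' b) (Pi.single j v) i = evalGR μ a v := by
  obtain ⟨a', ha', e⟩ := h b i j
  rw [e, inclGR_injective G (ha'.trans ha.symm)]

theorem IsLongMoody.unique {μ : FG G →* GLin V} {f f' : G →* GLin (Fin N → V)}
    (h : IsLongMoody G μ f) (h' : IsLongMoody G μ f') : f = f' := by
  refine MonoidHom.ext fun b => Units.ext (LinearMap.pi_ext fun j v => funext fun i => ?_)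
  exact (h.apply b i j _ (inclGR_phiRestrict b i j) v).trans
    (h'.apply b i j _ (inclGR_phiRestrict b i j) v).symm

end LongMoodyRep

/-! ### Iterating -/

theorem braidIncl_perm {N : ℕ} (b : BraidGroup N) (x : Fin N) :
    strandPerm (N + 1) (braidIncl N b) x.castSucc = (strandPerm N b x).castSucc := by
  induction b using σ_induction generalizing x with
  | one => simp
  | mul i h b ih =>
    rw [map_mul, map_mul, map_mul, Equiv.Perm.mul_apply, ih, braidIncl_σ, strandPerm_σ,
      strandPerm_σ, Equiv.Perm.mul_apply]
    simp only [Equiv.swap_apply_def, Fin.ext_iff, Fin.val_castSucc]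
    split_ifs <;> simp_all
  | inv_mul i h b ih =>
    rw [map_mul, map_mul, map_mul, Equiv.Perm.mul_apply, ih, map_inv, map_inv, map_inv,
      braidIncl_σ, strandPerm_σ, strandPerm_σ, Equiv.Perm.mul_apply, Equiv.swap_inv,
      Equiv.swap_inv]
    simp only [Equiv.swap_apply_def, Fin.ext_iff, Fin.val_castSucc]
    split_ifs <;> simp_all

theorem braidIncl_perm_last {N : ℕ} (b : BraidGroup N) :
    strandPerm (N + 1) (braidIncl N b) (Fin.last N) = Fin.last N := by
  by_contra hne
  obtain ⟨y, hy⟩ := Fin.exists_castSucc_eq.mpr hne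
  have h := braidIncl_perm b ((strandPerm N b).symm y)
  rw [Equiv.apply_symm_apply, hy] at h
  exact Fin.castSucc_ne_last _ ((strandPerm (N + 1) (braidIncl N b)).injective h)

theorem strandPerm_embed_inl {N : ℕ} (w : FreeGroup (Fin N)) :
    strandPerm (N + 1) (embed N (SemidirectProduct.inl w)) = 1 := by
  have : ((strandPerm (N + 1)).comp (embed N)).comp SemidirectProduct.inl = 1 := by
    refine FreeGroup.ext_hom _ _ fun i => ?_
    rw [MonoidHom.comp_apply, MonoidHom.comp_apply, embed, SemidirectProduct.lift_inl,
      FreeGroup.lift_apply_of, pureGen]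
    simp [strandPerm_σ, pow_two]
  exact DFunLike.congr_fun this w

/-- The free group maps to pure braids, and the added last strand is fixed by the image of
`B_{n+m}`. So only the permutation of `x.right` matters. -/
theorem embed_mem_mixedBraid {n m : ℕ} {x : FB (n + m)} (hx : x ∈ FG (mixedBraid n m)) :
    embed (n + m) x ∈ mixedBraid n (m + 1) := by
  change x.right ∈ mixedBraid n m at hx
  rw [mem_mixedBraid] at hx
  have hs : strandPerm (n + m + 1) (embed (n + m) x) =
      strandPerm (n + m + 1) (braidIncl (n + m) x.right) := by
    conv_lhs => rw [← SemidirectProduct.inl_left_mul_inr_right x]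
    rw [map_mul, map_mul, strandPerm_embed_inl, one_mul, embed, SemidirectProduct.lift_inr]
  refine mem_mixedBraid.mpr ?_
  change ∀ y : Fin (n + m + 1), (strandPerm (n + m + 1) (embed (n + m) x) y).1 < n ↔ y.1 < n
  rw [hs]
  intro y
  induction y using Fin.lastCases with
  | last => rw [braidIncl_perm_last]
  | cast y => rw [braidIncl_perm]; exact hx y

/-- The homomorphism `F_{n+m} ⋊ B_{n,m} → B_{n,m+1}`. -/
def embedRestrict (n m : ℕ) : FG (mixedBraid n m) →* mixedBraid n (m + 1) :=
  ((embed (n + m)).comp (FG (mixedBraid n m)).subtype).codRestrict (mixedBraid n (m + 1))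
    fun x => embed_mem_mixedBraid x.2

section Steps

variable {n m : ℕ} {V : Type*} [AddCommGroup V] [Module ℂ V]

theorem isLawrenceStep_iff {ρ : mixedBraid n (m + 1) →* GLin V}
    {ρ' : mixedBraid n m →* GLin (Fin (n + m) → V)} :
    IsLawrenceStep ρ ρ' ↔ IsLongMoody (mixedBraid n m) (ρ.comp (embedRestrict n m)) ρ' := by
  constructor
  · rintro ⟨μ, hμ, h⟩
    have : μ = ρ.comp (embedRestrict n m) := MonoidHom.ext fun x => (hμ x).2
    rwa [← this]
  · intro h
    exact ⟨_, fun x => ⟨embed_mem_mixedBraid x.2, rfl⟩, h⟩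

end Steps

/-- The induction varies the coefficient space, since each step replaces `W` by a direct sum of
copies of `W`. For `m = 0` the empty product leaves one copy. -/
theorem exists_isIterated.{u} (n : ℕ) : ∀ (m : ℕ) (W : Type u) [AddCommGroup W] [Module ℂ W]
    (ρ : mixedBraid n m →* GLin W), ∃ τ, IsIterated n m W ρ τ := by
  intro m
  induction m with
  | zero =>
    intro W _ _ ρ
    have hmem : ∀ b : BraidGroup n, b ∈ mixedBraid n 0 := fun b =>
      mem_mixedBraid.mpr fun x => ⟨fun _ => x.2, fun _ => Fin.is_lt _⟩
    let f : BraidGroup n →* Module.End ℂ (Fin (∏ j ∈ Finset.range 0, (n + j)) → W) :=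
      { toFun := fun b => (ρ ⟨b, hmem b⟩ : W →ₗ[ℂ] W).compLeft _
        map_one' := by
          have : (⟨1, hmem 1⟩ : mixedBraid n 0) = 1 := rfl
          rw [this, map_one]
          rfl
        map_mul' := fun b c => by
          have : (⟨b * c, hmem _⟩ : mixedBraid n 0) = ⟨b, hmem b⟩ * ⟨c, hmem c⟩ := rfl
          rw [this, map_mul]
          rfl }
    exact ⟨f.toHomUnits, fun b => ⟨hmem b, fun x i => rfl⟩⟩
  | succ m ih =>
    intro W _ _ ρ
    obtain ⟨ρ', hρ'⟩ := exists_isLongMoody (ρ.comp (embedRestrict n m))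
    obtain ⟨τ', hτ'⟩ := ih (Fin (n + m) → W) ρ'
    let e := flatten (Finset.prod_range_succ (fun j => n + j) m).symm W
    let f : BraidGroup n →* Module.End ℂ (Fin (∏ j ∈ Finset.range (m + 1), (n + j)) → W) :=
      { toFun := fun b => e.conj (τ' b : Module.End ℂ _)
        map_one' := by rw [map_one, Units.val_one]; exact e.conj_id
        map_mul' := fun b c => by
          rw [map_mul, Units.val_mul]; exact e.conj_comp _ _ }
    refine ⟨f.toHomUnits, ρ', τ', isLawrenceStep_iff.mpr hρ', hτ', fun b x => ?_⟩
    change e (act (τ' b) (e.symm (e x))) = e (act (τ' b) x)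
    rw [e.symm_apply_apply]

theorem IsIterated.unique.{u} {n : ℕ} : ∀ {m : ℕ} {W : Type u} [AddCommGroup W] [Module ℂ W]
    {ρ : mixedBraid n m →* GLin W}
    {τ τ' : BraidGroup n →* GLin (Fin (∏ j ∈ Finset.range m, (n + j)) → W)},
    IsIterated n m W ρ τ → IsIterated n m W ρ τ' → τ = τ' := by
  intro m
  induction m with
  | zero =>
    intro W _ _ ρ τ τ' h h'
    refine MonoidHom.ext fun b => Units.ext (LinearMap.ext fun x => funext fun i => ?_)
    exact ((h b).2 x i).trans ((h' b).2 x i).symm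
  | succ m ih =>
    rintro W _ _ ρ τ τ' ⟨f, g, hf, hg, hτ⟩ ⟨f', g', hf', hg', hτ'⟩
    rw [isLawrenceStep_iff] at hf hf'
    obtain rfl := hf.unique hf'
    obtain rfl := ih hg hg'
    refine MonoidHom.ext fun b => Units.ext (LinearMap.ext fun x => ?_)
    obtain ⟨x, rfl⟩ := (flatten (Finset.prod_range_succ (fun j => n + j) m).symm W).surjective x
    exact (hτ b x).trans (hτ' b x).symm

theorem existsUnique_isLawrence {V : Type*} [AddCommGroup V] [Module ℂ V] (n : ℕ) {m : ℕ}
    (ρ : BraidGroup m →* GLin V) (q : ℂˣ) :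
    ∃! τ : BraidGroup n →* GLin (Fin (∏ j ∈ Finset.range m, (n + j)) → V), IsLawrence ρ q τ := by
  obtain ⟨ρ', hρ'⟩ := exists_isExtension n ρ q
  obtain ⟨τ, hτ⟩ := exists_isIterated n m V ρ'
  refine ⟨τ, ⟨ρ', hρ', hτ⟩, ?_⟩
  rintro τ' ⟨ρ'', hρ'', hτ'⟩
  obtain rfl := hρ'.unique hρ''
  exact hτ'.unique hτ

/-! ### Matrix rows of the Long–Moody representation -/

section Rows

variable {N : ℕ} {G : Subgroup (BraidGroup N)} {V : Type*} [AddCommGroup V] [Module ℂ V]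
  {μ : FG G →* GLin V} {ρ' : G →* GLin (Fin N → V)}

theorem evalGR_of {H : Type*} [Group H] (ρ : H →* GLin V) (x : H) (v : V) :
    evalGR ρ (MonoidAlgebra.of ℤ H x) v = act (ρ x) v := by
  simp [evalGR]

theorem IsLongMoody.apply_row (h : IsLongMoody G μ ρ') (b : G) (x : Fin N → V) (i : Fin N)
    (a : Fin N → MonoidAlgebra ℤ (FG G))
    (ha : ∀ j, inclGR G (a j) = (phi N b : Matrix (Fin N) (Fin N) (GR N)) i j) :
    act (ρ' b) x i = ∑ j, evalGR μ (a j) (x j) := by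
  conv_lhs => rw [← Finset.univ_sum_single x]
  rw [act, map_sum, Finset.sum_apply]
  exact Finset.sum_congr rfl fun j _ => h.apply b i j (a j) (ha j) (x j)

theorem inclGR_single (j k : Fin N) (a : MonoidAlgebra ℤ (FG G)) :
    inclGR G ((Pi.single j a : Fin N → _) k) = rowSingle j (inclGR G a) k := by
  by_cases h : k = j
  · subst h; simp
  · simp [rowSingle, h]

theorem sum_single_eval (μ : FG G →* GLin V) (j : Fin N) (a : MonoidAlgebra ℤ (FG G))
    (x : Fin N → V) : ∑ k, evalGR μ ((Pi.single j a : Fin N → _) k) (x k) = evalGR μ a (x j) := by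
  rw [Finset.sum_eq_single j]
  · rw [Pi.single_eq_same]
  · intro k _ hk
    rw [Pi.single_eq_of_ne hk, map_zero, LinearMap.zero_apply]
  · simp

theorem IsLongMoody.apply_row_single (h : IsLongMoody G μ ρ') (b : G) (x : Fin N → V) (i : Fin N)
    (j : Fin N) (a : MonoidAlgebra ℤ (FG G))
    (ha : (phi N b : Matrix (Fin N) (Fin N) (GR N)) i = rowSingle j (inclGR G a)) :
    act (ρ' b) x i = evalGR μ a (x j) := by
  rw [h.apply_row b x i (Pi.single j a) fun k => by rw [ha, inclGR_single], sum_single_eval]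

theorem IsLongMoody.apply_row_add (h : IsLongMoody G μ ρ') (b : G) (x : Fin N → V) (i : Fin N)
    (j j' : Fin N) (a a' : MonoidAlgebra ℤ (FG G))
    (ha : (phi N b : Matrix (Fin N) (Fin N) (GR N)) i =
      rowSingle j (inclGR G a) + rowSingle j' (inclGR G a')) :
    act (ρ' b) x i = evalGR μ a (x j) + evalGR μ a' (x j') := by
  rw [h.apply_row b x i (Pi.single j a + Pi.single j' a') fun k => by
    rw [ha, Pi.add_apply, Pi.add_apply, map_add, inclGR_single, inclGR_single]]
  simp only [Pi.add_apply, map_add, LinearMap.add_apply, Finset.sum_add_distrib, sum_single_eval]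

/-- An element of `F_N`, as an element of `F_N ⋊ G`. -/
abbrev ggFG (G : Subgroup (BraidGroup N)) (i : ℕ) (h : i < N) : FG G := ⟨gg i h, one_mem G⟩

/-- A generator of the braid group that lies in `G`, as an element of `F_N ⋊ G`. -/
abbrev ssFG {i : ℕ} {h : i + 1 < N} (hG : σ i h ∈ G) : FG G := ⟨ss i h, hG⟩

theorem IsLongMoody.σ_self (h : IsLongMoody G μ ρ') {k : ℕ} {hk : k + 1 < N} (hG : σ k hk ∈ G)
    (x : Fin N → V) : act (ρ' ⟨σ k hk, hG⟩) x ⟨k, by omega⟩ =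
      act (μ (ssFG hG)) (act (μ (ggFG G k (by omega))) (x ⟨k + 1, hk⟩)) := by
  rw [h.apply_row_single _ x ⟨k, by omega⟩ ⟨k + 1, hk⟩
    (MonoidAlgebra.of ℤ _ (ssFG hG) * MonoidAlgebra.of ℤ _ (ggFG G k (by omega)))]
  · rw [map_mul, Module.End.mul_apply, evalGR_of, evalGR_of]
  · rw [phi_σ, phiGen_row_self, map_mul, inclGR_of, inclGR_of]

theorem IsLongMoody.σ_succ (h : IsLongMoody G μ ρ') {k : ℕ} {hk : k + 1 < N} (hG : σ k hk ∈ G)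
    (x : Fin N → V) : act (ρ' ⟨σ k hk, hG⟩) x ⟨k + 1, hk⟩ =
      act (μ (ssFG hG)) (x ⟨k, by omega⟩) + act (μ (ssFG hG)) (x ⟨k + 1, hk⟩ -
        act (μ (ggFG G k (by omega))) (x ⟨k + 1, hk⟩)) := by
  rw [h.apply_row_add _ x ⟨k + 1, hk⟩ ⟨k, by omega⟩ ⟨k + 1, hk⟩
    (MonoidAlgebra.of ℤ _ (ssFG hG)) (MonoidAlgebra.of ℤ _ (ssFG hG) *
      (1 - MonoidAlgebra.of ℤ _ (ggFG G k (by omega))))]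
  · rw [map_mul, Module.End.mul_apply, evalGR_of, evalGR_of, map_sub, map_one,
      LinearMap.sub_apply, evalGR_of, Module.End.one_apply]
  · rw [phi_σ, phiGen_row_succ, map_mul, inclGR_of, map_sub, map_one, inclGR_of]

theorem IsLongMoody.σ_ne (h : IsLongMoody G μ ρ') {k : ℕ} {hk : k + 1 < N} (hG : σ k hk ∈ G)
    (x : Fin N → V) {a : ℕ} (ha : a < N) (h1 : a ≠ k) (h2 : a ≠ k + 1) :
    act (ρ' ⟨σ k hk, hG⟩) x ⟨a, ha⟩ = act (μ (ssFG hG)) (x ⟨a, ha⟩) := by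
  rw [h.apply_row_single _ x ⟨a, ha⟩ ⟨a, ha⟩ (MonoidAlgebra.of ℤ _ (ssFG hG))]
  · rw [evalGR_of]
  · rw [phi_σ, phiGen_row_ne _ _ _ _ h1 h2, inclGR_of]

/-- The element `σ_i²` of `F_N ⋊ G`. -/
abbrev sqFG {i : ℕ} {h : i + 1 < N} (hG : σ i h ^ 2 ∈ G) : FG G :=
  ⟨ss i h * ss i h, by rwa [pow_two] at hG⟩

/-- The element `σ_i g_i σ_i` of `F_N ⋊ G`. -/
abbrev sgsFG {i : ℕ} {h : i + 1 < N} (hG : σ i h ^ 2 ∈ G) : FG G :=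
  ⟨ss i h * gg i (by omega) * ss i h, by
    change σ i h * 1 * σ i h ∈ G
    rwa [mul_one, ← pow_two]⟩

theorem sgsFG_eq {i : ℕ} {h : i + 1 < N} (hG : σ i h ^ 2 ∈ G) :
    sgsFG hG = sqFG hG * (ggFG G i (by omega) * ggFG G (i + 1) h * (ggFG G i (by omega))⁻¹) := by
  refine Subtype.ext ?_
  change ss i h * gg i _ * ss i h = ss i h * ss i h * (gg i _ * gg (i + 1) h * (gg i _)⁻¹)
  rw [mul_assoc, rel_self, mul_assoc (ss i h) (ss i h)]

/-- This serves for `k + 1 = n`, where `σ k` itself is not in the mixed braid group. The row is that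
of the square of `phi N (σ k hk)`, computed over the full group ring, and its entries are then
recognized in the smaller one. -/
theorem IsLongMoody.sq_self (h : IsLongMoody G μ ρ') {k : ℕ} {hk : k + 1 < N}
    (hG : σ k hk ^ 2 ∈ G) (x : Fin N → V) : act (ρ' ⟨σ k hk ^ 2, hG⟩) x ⟨k, by omega⟩ =
      act (μ (sgsFG hG)) (x ⟨k, by omega⟩) + act (μ (sgsFG hG)) (x ⟨k + 1, hk⟩ -
        act (μ (ggFG G k (by omega))) (x ⟨k + 1, hk⟩)) := by
  rw [h.apply_row_add _ x ⟨k, by omega⟩ ⟨k, by omega⟩ ⟨k + 1, hk⟩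
    (MonoidAlgebra.of ℤ _ (sgsFG hG)) (MonoidAlgebra.of ℤ _ (sgsFG hG) *
      (1 - MonoidAlgebra.of ℤ _ (ggFG G k (by omega))))]
  · rw [map_mul, Module.End.mul_apply, evalGR_of, evalGR_of, map_sub, map_one,
      LinearMap.sub_apply, evalGR_of, Module.End.one_apply]
  · rw [map_pow, pow_two, phi_σ, Units.val_mul, row_mul, phiGen_row_self,
      vecMul_single_matrix₂ _ _ _ _ _ _ _ (phiGen_row_succ k hk), map_mul, inclGR_of, map_sub,
      map_one, inclGR_of]
    simp only [map_mul, mul_assoc]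

theorem IsLongMoody.sq_succ (h : IsLongMoody G μ ρ') {k : ℕ} {hk : k + 1 < N}
    (hG : σ k hk ^ 2 ∈ G) (x : Fin N → V) : act (ρ' ⟨σ k hk ^ 2, hG⟩) x ⟨k + 1, hk⟩ =
      (act (μ (sqFG hG)) (x ⟨k, by omega⟩) - act (μ (sgsFG hG)) (x ⟨k, by omega⟩)) +
        (act (μ (sqFG hG)) (x ⟨k + 1, hk⟩) - act (μ (sgsFG hG)) (x ⟨k + 1, hk⟩ -
          act (μ (ggFG G k (by omega))) (x ⟨k + 1, hk⟩))) := by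
  rw [h.apply_row_add _ x ⟨k + 1, hk⟩ ⟨k, by omega⟩ ⟨k + 1, hk⟩
    (MonoidAlgebra.of ℤ _ (sqFG hG) - MonoidAlgebra.of ℤ _ (sgsFG hG))
    (MonoidAlgebra.of ℤ _ (sqFG hG) - MonoidAlgebra.of ℤ _ (sgsFG hG) *
      (1 - MonoidAlgebra.of ℤ _ (ggFG G k (by omega))))]
  · simp only [map_mul, Module.End.mul_apply, evalGR_of, map_sub, map_one,
      LinearMap.sub_apply, Module.End.one_apply]
  · rw [map_pow, pow_two, phi_σ, Units.val_mul, row_mul, phiGen_row_succ, Matrix.add_vecMul,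
      vecMul_single_matrix₂ _ _ _ _ _ _ _ (phiGen_row_succ k hk),
      vecMul_single_matrix _ _ _ _ _ (phiGen_row_self k hk), map_sub, map_sub, map_mul,
      inclGR_of, inclGR_of, map_sub, map_one, inclGR_of, add_left_comm, ← rowSingle_add]
    congr 2
    · simp only [map_mul]; noncomm_ring
    · simp only [map_mul]; noncomm_ring

theorem IsLongMoody.sq_ne (h : IsLongMoody G μ ρ') {k : ℕ} {hk : k + 1 < N}
    (hG : σ k hk ^ 2 ∈ G) (x : Fin N → V) {a : ℕ} (ha : a < N) (h1 : a ≠ k) (h2 : a ≠ k + 1) :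
    act (ρ' ⟨σ k hk ^ 2, hG⟩) x ⟨a, ha⟩ = act (μ (sqFG hG)) (x ⟨a, ha⟩) := by
  rw [h.apply_row_single _ x ⟨a, ha⟩ ⟨a, ha⟩ (MonoidAlgebra.of ℤ _ (sqFG hG))]
  · rw [evalGR_of]
  · rw [map_pow, pow_two, phi_σ, Units.val_mul, row_mul, phiGen_row_ne _ _ _ _ h1 h2,
      vecMul_single_matrix _ _ _ _ _ (phiGen_row_ne k hk a ha h1 h2), inclGR_of, ← map_mul]

end Rows

/-! ### The first step for `m = 2` -/

/-- The scalar by which an element of `GL(ℂ)` acts. -/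
def scalarOf : GLin ℂ →* ℂ where
  toFun x := act x 1
  map_one' := rfl
  map_mul' x y := by
    change act x (act y 1) = _
    conv_lhs => rw [← mul_one (act y 1), ← smul_eq_mul, act, map_smul, smul_eq_mul, mul_comm]

theorem act_eq_mul (x : GLin ℂ) (v : ℂ) : act x v = scalarOf x * v := by
  conv_lhs => rw [← mul_one v, ← smul_eq_mul, act, map_smul, smul_eq_mul, mul_comm]
  rfl

/-- A multiplicative character does not see conjugation. This evaluates the extension on all `g_k`
from its values on the standard generators. -/
theorem map_conj_eq {H : Type*} [Group H] (f : H →* ℂ) {x y z : H} (h : x * y = y * z) :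
    f x = f z := by
  have h1 := congrArg f (eq_mul_inv_of_mul_eq h)
  rw [map_mul, map_mul, mul_right_comm, ← map_mul, mul_inv_cancel, map_one, one_mul] at h1
  exact h1

theorem embed_ss {N i : ℕ} (h : i + 1 < N) : embed N (ss i h) = σ i (by omega) := by
  rw [embed, ss, SemidirectProduct.lift_inr, braidIncl_σ]

theorem embed_gg {N i : ℕ} (h : i < N) : embed N (gg i h) = pureGen N i h := by
  rw [embed, gg, SemidirectProduct.lift_inl, FreeGroup.lift_apply_of]

theorem pureGen_last {N i : ℕ} (h : i < N) (hi : i + 1 = N) :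
    pureGen N i h = σ i (by omega) ^ 2 := by
  rw [pureGen, descProd_of_not (by omega)]; simp

section FirstStep

variable {n : ℕ} {q t : ℂˣ} {ρ : BraidGroup 2 →* GLin ℂ} {ρ' : mixedBraid n 2 →* GLin ℂ}

/-- The scalars by which `F_{n+1} ⋊ B_{n,1}` acts on the extension. -/
def stepScalar (ρ' : mixedBraid n 2 →* GLin ℂ) : FG (mixedBraid n 1) →* ℂ :=
  scalarOf.comp (ρ'.comp (embedRestrict n 1))

theorem stepScalar_ss (hρ' : IsExtension ρ q ρ') {k : ℕ} (hk : k + 1 < n)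
    (hG : (σ k (by omega) : BraidGroup (n + 1)) ∈ mixedBraid n 1) :
    stepScalar ρ' (ssFG hG) = 1 := by
  obtain ⟨h1, h2⟩ := hρ'.left k hk
  have e : embedRestrict n 1 (ssFG hG) = ⟨σ k (by omega), h1⟩ := Subtype.ext (embed_ss _)
  change scalarOf (ρ' (embedRestrict n 1 (ssFG hG))) = 1
  rw [e, h2, map_one]

theorem scalarOf_middle (hρ' : IsExtension ρ q ρ') {k : ℕ} (hk : k + 1 = n)
    (hG : (σ k (by omega) : BraidGroup (n + 2)) ^ 2 ∈ mixedBraid n 2) :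
    scalarOf (ρ' ⟨_, hG⟩) = q := by
  obtain ⟨h1, h2⟩ := hρ'.middle k hk (by omega)
  exact (h2 1).trans (mul_one _)

theorem stepScalar_sq (hρ' : IsExtension ρ q ρ') {k : ℕ} (hk : k + 1 = n)
    (hG : (σ k (by omega) : BraidGroup (n + 1)) ^ 2 ∈ mixedBraid n 1) :
    stepScalar ρ' (sqFG hG) = q := by
  rw [← scalarOf_middle hρ' hk (σ_sq_mem_mixedBraid _)]
  refine congrArg (fun x => scalarOf (ρ' x)) (Subtype.ext ?_)
  change embed (n + 1) (ss k _ * ss k _) = _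
  rw [map_mul, embed_ss]
  exact (pow_two _).symm

theorem stepScalar_gg_last (hρ' : IsExtension ρ q ρ')
    (hρ : ∀ z : ℂ, act (ρ (σ 0 (by norm_num))) z = (t : ℂ) * z) :
    stepScalar ρ' (ggFG (mixedBraid n 1) n (by omega)) = (t : ℂ) ^ 2 := by
  obtain ⟨h1, h2⟩ := hρ'.right 0 (by omega)
  have e : embedRestrict n 1 (ggFG (mixedBraid n 1) n (by omega)) =
      ⟨σ (n + 0) (by omega), h1⟩ ^ 2 :=
    Subtype.ext ((embed_gg _).trans (pureGen_last _ rfl))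
  change scalarOf (ρ' (embedRestrict n 1 (ggFG (mixedBraid n 1) n (by omega)))) = _
  rw [e, map_pow, h2, map_pow]
  congr 1
  exact (hρ 1).trans (mul_one _)

theorem stepScalar_gg (hρ' : IsExtension ρ q ρ') {k : ℕ} (hk : k < n) :
    stepScalar ρ' (ggFG (mixedBraid n 1) k (by omega)) = q := by
  obtain ⟨d, hd⟩ : ∃ d, k + 1 + d = n := Nat.exists_eq_add_of_le hk |>.imp fun _ h => h.symm
  induction d generalizing k with
  | zero =>
    rw [← scalarOf_middle hρ' hd (σ_sq_mem_mixedBraid _)]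
    let s : mixedBraid n 2 := ⟨σ n (by omega), σ_mem_mixedBraid _ (by omega)⟩
    -- For `k + 1 = n` the image of `g_k` is the conjugate of `σ k ^ 2` by `σ n`, and `σ n` lies in
    -- `B_{n,2}`.
    refine map_conj_eq (scalarOf.comp ρ') (y := s) (Subtype.ext ?_)
    change embed (n + 1) (gg k _) * σ n _ = σ n _ * σ k _ ^ 2
    obtain rfl : k + 1 = n := hd
    rw [embed_gg, pureGen, descProd_of_lt (by omega), descProd_of_not (by omega), one_mul,
      inv_mul_cancel_right]
  | succ d ih =>
    rw [← ih (k := k + 1) (by omega) (by omega), eq_comm]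
    refine map_conj_eq (stepScalar ρ')
      (y := ssFG (σ_mem_mixedBraid (n := n) (m := 1) (i := k) (by omega) (by omega)))
      (Subtype.ext (rel_succ k (by omega)))

theorem stepScalar_sgs (hρ' : IsExtension ρ q ρ')
    (hρ : ∀ z : ℂ, act (ρ (σ 0 (by norm_num))) z = (t : ℂ) * z) {k : ℕ} (hk : k + 1 = n)
    (hG : (σ k (by omega) : BraidGroup (n + 1)) ^ 2 ∈ mixedBraid n 1) :
    stepScalar ρ' (sgsFG hG) = q * (t : ℂ) ^ 2 := by
  subst hk
  rw [sgsFG_eq, map_mul, stepScalar_sq hρ' rfl]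
  congr 1
  rw [← stepScalar_gg_last hρ' hρ]
  exact map_conj_eq _ (y := ggFG (mixedBraid (k + 1) 1) k (by omega)) (by group)

variable {ρ₁ : mixedBraid n 1 →* GLin (Fin (n + 1) → ℂ)}

theorem step_σ (hρ' : IsExtension ρ q ρ') (hs : IsLawrenceStep ρ' ρ₁) {k : ℕ} (hk : k + 1 < n)
    (hG : (σ k (by omega) : BraidGroup (n + 1)) ∈ mixedBraid n 1) (x : Fin (n + 1) → ℂ) :
    act (ρ₁ ⟨_, hG⟩) x = fun a => if a.1 = k then q * x ⟨k + 1, by omega⟩ else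
      if a.1 = k + 1 then x ⟨k, by omega⟩ + (1 - q) * x ⟨k + 1, by omega⟩ else x a := by
  rw [isLawrenceStep_iff] at hs
  have e1 := stepScalar_ss hρ' hk hG
  have e2 := stepScalar_gg hρ' (k := k) (by omega)
  have f : ∀ y v, act ((ρ'.comp (embedRestrict n 1)) y) v = stepScalar ρ' y * v :=
    fun y v => act_eq_mul _ _
  funext ⟨a, ha⟩
  by_cases h1 : a = k
  · subst h1
    rw [hs.σ_self, f, f, e1, e2]; simp
  by_cases h2 : a = k + 1
  · subst h2
    rw [hs.σ_succ, f, f, f, e1, e2]; simp; ring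
  · rw [hs.σ_ne _ _ _ h1 h2, f, e1]; simp [h1, h2]

theorem step_sq (hρ' : IsExtension ρ q ρ') (hs : IsLawrenceStep ρ' ρ₁)
    (hρ : ∀ z : ℂ, act (ρ (σ 0 (by norm_num))) z = (t : ℂ) * z) {k : ℕ} (hk : k + 1 = n)
    (hG : (σ k (by omega) : BraidGroup (n + 1)) ^ 2 ∈ mixedBraid n 1) (x : Fin (n + 1) → ℂ) :
    act (ρ₁ ⟨_, hG⟩) x = fun a =>
      if a.1 = k then q * (t : ℂ) ^ 2 * (x ⟨k, by omega⟩ + (1 - q) * x ⟨k + 1, by omega⟩) else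
      if a.1 = k + 1 then q * (1 - (t : ℂ) ^ 2) * x ⟨k, by omega⟩ +
        q * (1 - (t : ℂ) ^ 2 * (1 - q)) * x ⟨k + 1, by omega⟩ else q * x a := by
  rw [isLawrenceStep_iff] at hs
  have e1 := stepScalar_sq hρ' hk hG
  have e2 := stepScalar_gg hρ' (k := k) (by omega)
  have e3 := stepScalar_sgs hρ' hρ hk hG
  have f : ∀ y v, act ((ρ'.comp (embedRestrict n 1)) y) v = stepScalar ρ' y * v :=
    fun y v => act_eq_mul _ _
  funext ⟨a, ha⟩
  by_cases h1 : a = k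
  · subst h1
    rw [hs.sq_self, f, f, f, e2, e3]; simp; ring
  by_cases h2 : a = k + 1
  · subst h2
    rw [hs.sq_succ, f, f, f, f, f, e1, e2, e3]; simp; ring
  · rw [hs.sq_ne _ _ _ h1 h2, f, e1]; simp [h1, h2]

end FirstStep

/-! ### The vectors spanning the Lawrence–Krammer subrepresentation -/

/-- The vector `e_i - e_n` of `ℂ^{n+1}`. -/
def arcVec (n i : ℕ) : Fin (n + 1) → ℂ := fun a => if a.1 = i then 1 else if a.1 = n then -1 else 0

section SecondStep

variable {n : ℕ} {q t : ℂˣ} {ρ : BraidGroup 2 →* GLin ℂ} {ρ' : mixedBraid n 2 →* GLin ℂ}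
  {ρ₁ : mixedBraid n 1 →* GLin (Fin (n + 1) → ℂ)}

theorem step_σ_self (hρ' : IsExtension ρ q ρ') (hs : IsLawrenceStep ρ' ρ₁) {k : ℕ}
    (hk : k + 1 < n) (hG : (σ k (by omega) : BraidGroup (n + 1)) ∈ mixedBraid n 1) :
    act (ρ₁ ⟨_, hG⟩) (arcVec n k) = arcVec n (k + 1) := by
  rw [step_σ hρ' hs hk]
  funext a
  simp only [arcVec]
  split_ifs <;> first | omega | simp

theorem step_σ_succ (hρ' : IsExtension ρ q ρ') (hs : IsLawrenceStep ρ' ρ₁) {k : ℕ}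
    (hk : k + 1 < n) (hG : (σ k (by omega) : BraidGroup (n + 1)) ∈ mixedBraid n 1) :
    act (ρ₁ ⟨_, hG⟩) (arcVec n (k + 1)) =
      (q : ℂ) • arcVec n k + (1 - (q : ℂ)) • arcVec n (k + 1) := by
  rw [step_σ hρ' hs hk]
  funext a
  simp only [arcVec, Pi.add_apply, Pi.smul_apply, smul_eq_mul]
  split_ifs <;> first | omega | (simp; done) | ring

theorem step_σ_ne (hρ' : IsExtension ρ q ρ') (hs : IsLawrenceStep ρ' ρ₁) {k : ℕ}
    (hk : k + 1 < n) (hG : (σ k (by omega) : BraidGroup (n + 1)) ∈ mixedBraid n 1) {i : ℕ}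
    (h1 : i ≠ k) (h2 : i ≠ k + 1) : act (ρ₁ ⟨_, hG⟩) (arcVec n i) = arcVec n i := by
  rw [step_σ hρ' hs hk]
  funext a
  simp only [arcVec]
  split_ifs <;> first | omega | simp

theorem pureGen_mem_mixedBraid {n k : ℕ} (h : k < n) : pureGen n k h ∈ mixedBraid n 1 := by
  have := embed_mem_mixedBraid (n := n) (m := 0) (x := gg k h) (one_mem (mixedBraid n 0))
  rwa [show embed (n + 0) (gg k h) = pureGen n k h from embed_gg h] at this

/-- For `k = n - 1` the pure braid is `σ k ^ 2`, already computed. Smaller `k` follow by descending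
induction, since `σ k` conjugates the `k`-th pure braid to the next one and acts on the arc vectors
by known formulas. -/
theorem step_pureGen (hρ' : IsExtension ρ q ρ') (hs : IsLawrenceStep ρ' ρ₁)
    (hρ : ∀ z : ℂ, act (ρ (σ 0 (by norm_num))) z = (t : ℂ) * z) {k : ℕ} (hk : k < n) :
    act (ρ₁ ⟨_, pureGen_mem_mixedBraid hk⟩) (arcVec n k) =
        ((q : ℂ) ^ 2 * (t : ℂ) ^ 2) • arcVec n k ∧
      (∀ j < k, act (ρ₁ ⟨_, pureGen_mem_mixedBraid hk⟩) (arcVec n j) =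
        (q : ℂ) • arcVec n j - ((q : ℂ) * (1 - q) * (t : ℂ) ^ 2) • arcVec n k) ∧
      (∀ j, k < j → j < n → act (ρ₁ ⟨_, pureGen_mem_mixedBraid hk⟩) (arcVec n j) =
        (q : ℂ) • arcVec n j - ((q : ℂ) * (1 - q)) • arcVec n k) := by
  obtain ⟨d, hd⟩ : ∃ d, k + 1 + d = n := Nat.exists_eq_add_of_le hk |>.imp fun _ h => h.symm
  induction d generalizing k with
  | zero =>
    have e : ∀ x, act (ρ₁ ⟨_, pureGen_mem_mixedBraid hk⟩) x =
        act (ρ₁ ⟨_, σ_sq_mem_mixedBraid (i := k) (by omega)⟩) x := by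
      intro x
      exact congrArg (fun y => act (ρ₁ y) x) (Subtype.ext (pureGen_last hk hd))
    simp only [e, step_sq hρ' hs hρ hd]
    refine ⟨?_, fun j hj => ?_, fun j hj hj' => by omega⟩
    · funext a
      simp only [arcVec, Pi.smul_apply, smul_eq_mul]
      split_ifs <;> first | omega | (simp; try ring)
    · funext a
      simp only [arcVec, Pi.smul_apply, Pi.sub_apply, smul_eq_mul]
      split_ifs <;> first | omega | (simp; try ring)
  | succ d ih =>
    have hk' : k + 1 < n := by omega
    obtain ⟨i1, i2, i3⟩ := ih hk' (by omega)
    have hG : (σ k (by omega) : BraidGroup (n + 1)) ∈ mixedBraid n 1 :=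
      σ_mem_mixedBraid _ (by omega)
    have hc : ∀ x, act (ρ₁ ⟨_, hG⟩) (act (ρ₁ ⟨_, pureGen_mem_mixedBraid hk⟩) x) =
        act (ρ₁ ⟨_, pureGen_mem_mixedBraid hk'⟩) (act (ρ₁ ⟨_, hG⟩) x) := by
      intro x
      have e : (⟨_, hG⟩ : mixedBraid n 1) * ⟨_, pureGen_mem_mixedBraid hk⟩ =
          ⟨_, pureGen_mem_mixedBraid hk'⟩ * ⟨_, hG⟩ := Subtype.ext (pureGen_succ hk').symm
      have := congrArg (fun y => act (ρ₁ y) x) e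
      simp only [map_mul] at this
      exact this
    -- Each formula for `k` is checked after applying the invertible operator of `σ k`, which turns
    -- it into the formulas for `k + 1`.
    have hinj : ∀ x y, act (ρ₁ ⟨_, hG⟩) x = act (ρ₁ ⟨_, hG⟩) y → x = y := by
      change Function.Injective (act (ρ₁ ⟨_, hG⟩))
      refine Function.LeftInverse.injective (g := act (ρ₁ ⟨_, hG⟩)⁻¹) fun x => ?_
      change ((ρ₁ ⟨_, hG⟩)⁻¹ * ρ₁ ⟨_, hG⟩ : GLin _).val x = x
      rw [inv_mul_cancel]
      rfl
    have s1 := step_σ_self hρ' hs hk' hG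
    have s2 := step_σ_succ hρ' hs hk' hG
    have s3 := fun i h1 h2 => step_σ_ne hρ' hs hk' hG (i := i) h1 h2
    simp only [act] at hc hinj s1 s2 s3 i1 i2 i3 ⊢
    refine ⟨?_, fun j hj => ?_, fun j hj hj' => ?_⟩
    · apply hinj
      rw [hc, s1, i1, map_smul, s1]
    · apply hinj
      rw [hc, s3 j (by omega) (by omega), i2 j (by omega), map_sub, map_smul, map_smul, s1,
        s3 j (by omega) (by omega)]
    · apply hinj
      by_cases hj1 : j = k + 1
      · subst hj1
        -- The two terms with `t²` cancel here, which is why the coefficient for `j > k` is free of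
        -- `t`; both sides are `q²` times `arcVec n k`.
        rw [hc, s2, map_add, map_smul, map_smul, i1, i2 k (by omega), map_sub, map_smul, map_smul,
          s1, s2]
        module
      · rw [hc, s3 j (by omega) (by omega), i3 j (by omega) hj', map_sub, map_smul, map_smul, s1,
          s3 j (by omega) (by omega)]

/-- The image `(e_i - e_j) ⊗ ((e_i - e_n) + t (e_j - e_n))` of `x_{i,j}`. -/
def forkVec (n : ℕ) (t : ℂ) (i j : ℕ) : Fin n → Fin (n + 1) → ℂ := fun a =>
  if a.1 = i then arcVec n i + t • arcVec n j
  else if a.1 = j then -(arcVec n i + t • arcVec n j) else 0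

variable {ρ₂ : mixedBraid n 0 →* GLin (Fin (n + 0) → Fin (n + 1) → ℂ)}

theorem second_step_apply (hs' : IsLawrenceStep ρ₁ ρ₂) {k : ℕ} (hk : k + 1 < n)
    (hG : (σ k hk : BraidGroup (n + 0)) ∈ mixedBraid n 0)
    (hG' : (σ k (by omega) : BraidGroup (n + 1)) ∈ mixedBraid n 1)
    (x : Fin n → Fin (n + 1) → ℂ) :
    act (ρ₂ ⟨σ k hk, hG⟩) x = fun a =>
      if a.1 = k then act (ρ₁ ⟨_, hG'⟩)
        (act (ρ₁ ⟨_, pureGen_mem_mixedBraid (k := k) (by omega)⟩) (x ⟨k + 1, hk⟩))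
      else if a.1 = k + 1 then act (ρ₁ ⟨_, hG'⟩) (x ⟨k, by omega⟩) +
        act (ρ₁ ⟨_, hG'⟩) (x ⟨k + 1, hk⟩ -
          act (ρ₁ ⟨_, pureGen_mem_mixedBraid (k := k) (by omega)⟩) (x ⟨k + 1, hk⟩))
      else act (ρ₁ ⟨_, hG'⟩) (x a) := by
  rw [isLawrenceStep_iff] at hs'
  have e1 : (ρ₁.comp (embedRestrict n 0)) (ssFG hG) = ρ₁ ⟨_, hG'⟩ :=
    congrArg ρ₁ (Subtype.ext (embed_ss _))
  have e2 : (ρ₁.comp (embedRestrict n 0)) (ggFG (mixedBraid n 0) k (by omega)) =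
      ρ₁ ⟨_, pureGen_mem_mixedBraid (k := k) (by omega)⟩ :=
    congrArg ρ₁ (Subtype.ext (embed_gg _))
  funext ⟨a, ha⟩
  by_cases h1 : a = k
  · subst h1
    rw [if_pos rfl]
    exact (hs'.σ_self hG x).trans (by rw [e1, e2])
  by_cases h2 : a = k + 1
  · subst h2
    rw [if_neg h1, if_pos rfl]
    exact (hs'.σ_succ hG x).trans (by rw [e1, e2])
  · rw [if_neg h1, if_neg h2]
    exact (hs'.σ_ne hG x ha h1 h2).trans (by rw [e1])

/-- The weight `t` in `forkVec` comes from the case `i = k`, `j = k + 1`. With `a_i = arcVec n i`,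
the operator of `σ_k g_k` sends `a_k` to `q² t² a_{k+1}` and `a_{k+1}` to `q² a_k`, so `a_k + t
a_{k+1}` is an eigenvector with eigenvalue `t q²`. The opposite signs in the coordinates `i` and `j`
turn it into `-t q²`. -/
theorem forkVec_action (hρ' : IsExtension ρ q ρ') (hs : IsLawrenceStep ρ' ρ₁)
    (hρ : ∀ z : ℂ, act (ρ (σ 0 (by norm_num))) z = (t : ℂ) * z)
    (hs' : IsLawrenceStep ρ₁ ρ₂) {k : ℕ} (hk : k + 1 < n)
    (hG : (σ k hk : BraidGroup (n + 0)) ∈ mixedBraid n 0) {i j : ℕ} (hij : i < j) (hj : j < n) :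
    act (ρ₂ ⟨σ k hk, hG⟩) (forkVec n t i j) =
      if k + 1 = i then
        (q : ℂ) • forkVec n t k j + ((q : ℂ) ^ 2 - q) • forkVec n t k i +
          (1 - (q : ℂ)) • forkVec n t i j
      else if k = i ∧ k + 1 = j then -((t : ℂ) * (q : ℂ) ^ 2) • forkVec n t i j
      else if k = i then forkVec n t (i + 1) j
      else if k + 1 = j then
        (q : ℂ) • forkVec n t i k + (1 - (q : ℂ)) • forkVec n t i j
          - (((q : ℂ) ^ 2 - q) * t) • forkVec n t k j
      else if k = j then forkVec n t i (j + 1)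
      else forkVec n t i j := by
  have hG' : (σ k (by omega) : BraidGroup (n + 1)) ∈ mixedBraid n 1 :=
    σ_mem_mixedBraid _ (by omega)
  refine (second_step_apply hs' hk hG hG' _).trans ?_
  obtain ⟨g1, g2, g3⟩ := step_pureGen hρ' hs hρ (k := k) (by omega)
  have s1 := step_σ_self hρ' hs hk hG'
  have s2 := step_σ_succ hρ' hs hk hG'
  have s3 := fun i h1 h2 => step_σ_ne hρ' hs hk hG' (i := i) h1 h2
  simp only [act] at g1 g2 g3 s1 s2 s3 ⊢
  -- From here only linearity and the formulas on the arc vectors are used, coordinate by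
  -- coordinate.
  generalize ((ρ₁ ⟨pureGen n k _, _⟩ : GLin (Fin (n + 1) → ℂ)) :
    (Fin (n + 1) → ℂ) →ₗ[ℂ] Fin (n + 1) → ℂ) = A at *
  generalize ((ρ₁ ⟨σ k _, hG'⟩ : GLin (Fin (n + 1) → ℂ)) :
    (Fin (n + 1) → ℂ) →ₗ[ℂ] Fin (n + 1) → ℂ) = B at *
  by_cases c1 : k + 1 = i
  · subst c1
    have b1 := s3 j (by omega) (by omega)
    have b2 := g3 (k + 1) (by omega) (by omega)
    have b3 := g3 j (by omega) (by omega)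
    rw [if_pos rfl]
    funext a
    simp only [forkVec, Pi.add_apply, Pi.smul_apply]
    split_ifs <;> first | omega |
      (simp only [map_add, map_neg, map_smul, map_sub, map_zero, s1, s2, b1, b2, b3]; module)
  rw [if_neg c1]
  by_cases c2 : k = i
  · subst c2
    by_cases c3 : k + 1 = j
    · subst c3
      have b1 := g3 (k + 1) (by omega) (by omega)
      rw [if_pos ⟨rfl, rfl⟩]
      funext a
      simp only [forkVec, Pi.smul_apply]
      split_ifs <;> first | omega |
        (simp only [map_add, map_neg, map_smul, map_sub, map_zero, g1, s1, s2, b1]; module)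
    · have b1 := s3 j (by omega) (by omega)
      rw [if_neg (by omega), if_pos rfl]
      funext a
      simp only [forkVec]
      split_ifs <;> first | omega |
        (simp only [map_add, map_neg, map_smul, map_sub, map_zero, s1, b1]; try module)
  rw [if_neg (by omega), if_neg c2]
  have b1 := s3 i (by omega) (by omega)
  by_cases c3 : k + 1 = j
  · subst c3
    have b2 := g2 i (by omega)
    have b3 := g3 (k + 1) (by omega) (by omega)
    rw [if_pos rfl]
    funext a
    simp only [forkVec, Pi.add_apply, Pi.smul_apply, Pi.sub_apply]
    split_ifs <;> first | omega |
      (simp only [map_add, map_neg, map_smul, map_sub, map_zero, s1, s2, b1, b2, b3]; module)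
  rw [if_neg c3]
  by_cases c4 : k = j
  · subst c4
    rw [if_pos rfl]
    funext a
    simp only [forkVec]
    split_ifs <;> first | omega |
      (simp only [map_add, map_neg, map_smul, map_sub, map_zero, s1, b1]; try module)
  have b2 := s3 j (by omega) (by omega)
  rw [if_neg c4]
  funext a
  simp only [forkVec]
  split_ifs <;> first | omega |
    (simp only [map_add, map_neg, map_smul, map_sub, map_zero, b1, b2]; try module)

end SecondStep

/-! ### The Lawrence–Krammer subrepresentation -/

/-- It suffices that the generators map the image of `f` into itself. The image has finite
dimension, so the restricted injective operators are surjective, and inverses preserve it too. -/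
theorem exists_subrepresentation {n : ℕ} {U W : Type*} [AddCommGroup U] [Module ℂ U]
    [FiniteDimensional ℂ U] [AddCommGroup W] [Module ℂ W] (τ : BraidGroup n →* GLin W)
    (f : U →ₗ[ℂ] W) (hf : Function.Injective f)
    (h : ∀ k hk u, act (τ (σ k hk)) (f u) ∈ LinearMap.range f) :
    ∃ κ : BraidGroup n →* GLin U, ∀ b x, f (act (κ b) x) = act (τ b) (f x) := by
  have hinv : ∀ b : BraidGroup n, ∀ w ∈ LinearMap.range f, act (τ b) w ∈ LinearMap.range f := by
    intro b
    induction b using σ_induction with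
    | one => intro w hw; rwa [map_one]
    | mul k hk b ih =>
      intro w hw
      obtain ⟨u, hu⟩ := ih w hw
      have := h k hk u
      rw [hu] at this
      rwa [map_mul]
    | inv_mul k hk b ih =>
      intro w hw
      let L : LinearMap.range f →ₗ[ℂ] LinearMap.range f :=
        (τ (σ k hk) : W →ₗ[ℂ] W).restrict (by rintro _ ⟨u, rfl⟩; exact h k hk u)
      have hl : ∀ v, act (τ (σ k hk))⁻¹ (act (τ (σ k hk)) v) = v := by
        intro v
        change ((τ (σ k hk))⁻¹ * τ (σ k hk) : GLin W).val v = v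
        rw [inv_mul_cancel]
        rfl
      have hL : Function.Injective L := by
        intro x y hxy
        refine Subtype.ext ?_
        rw [← hl x, ← hl y]
        exact congrArg _ (congrArg Subtype.val hxy)
      obtain ⟨v, hv⟩ := LinearMap.injective_iff_surjective.mp hL ⟨_, ih w hw⟩
      have hv' : act (τ (σ k hk)) v.1 = act (τ b) w := congrArg Subtype.val hv
      rw [map_mul, map_inv]
      change act (τ (σ k hk))⁻¹ (act (τ b) w) ∈ _
      rw [← hv', hl]
      exact v.2
  let e := LinearEquiv.ofInjective f hf
  let F : BraidGroup n → Module.End ℂ U := fun b =>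
    e.symm.toLinearMap ∘ₗ (τ b : W →ₗ[ℂ] W).restrict (hinv b) ∘ₗ e.toLinearMap
  have hF : ∀ b x, f (F b x) = act (τ b) (f x) := fun b x =>
    congrArg Subtype.val (e.apply_symm_apply ((τ b : W →ₗ[ℂ] W).restrict (hinv b) (e x)))
  let κ : BraidGroup n →* Module.End ℂ U :=
    { toFun := F
      map_one' := LinearMap.ext fun x => hf (by rw [hF, map_one]; rfl)
      map_mul' := fun b c => LinearMap.ext fun x => hf (by
        rw [hF, map_mul, Module.End.mul_apply, hF, hF]; rfl) }
  exact ⟨κ.toHomUnits, hF⟩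

/-- The braid relations for the Lawrence–Krammer matrices need no separate check: the matrices are
those of a representation restricted to an invariant subspace. -/
theorem exists_lawrenceKrammer {n : ℕ} {q t : ℂˣ} {W : Type*} [AddCommGroup W] [Module ℂ W]
    (τ : BraidGroup n →* GLin W) (X : ℕ → ℕ → W)
    (hX : LinearIndependent ℂ fun p : Pairs n => X p.1.1 p.1.2)
    (h : ∀ (k : ℕ) (hk : k + 1 < n) (i j : ℕ), i < j → j < n →
      act (τ (σ k hk)) (X i j) =
        if k + 1 = i then
          (q : ℂ) • X k j + ((q : ℂ) ^ 2 - q) • X k i + (1 - (q : ℂ)) • X i j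
        else if k = i ∧ k + 1 = j then -((t : ℂ) * (q : ℂ) ^ 2) • X i j
        else if k = i then X (i + 1) j
        else if k + 1 = j then
          (q : ℂ) • X i k + (1 - (q : ℂ)) • X i j - (((q : ℂ) ^ 2 - q) * t) • X k j
        else if k = j then X i (j + 1)
        else X i j) :
    ∃ κ : BraidGroup n →* GLin (Pairs n → ℂ), IsLawrenceKrammer q t κ ∧
      ∃ f : (Pairs n → ℂ) →ₗ[ℂ] W, Function.Injective f ∧
        ∀ b x, f (act (κ b) x) = act (τ b) (f x) := by
  let f : (Pairs n → ℂ) →ₗ[ℂ] W := Fintype.linearCombination ℂ fun p : Pairs n => X p.1.1 p.1.2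
  have hf : Function.Injective f := hX.fintypeLinearCombination_injective
  have hpair : ∀ p : Pairs n, (pairVec p.1.1 p.1.2 : Pairs n → ℂ) = Pi.single p 1 := by
    intro p
    funext p'
    simp only [pairVec, Pi.single_apply]
    congr 1
    simp only [Subtype.ext_iff, Prod.ext_iff, Fin.ext_iff]
  have hfX : ∀ i j, i < j → j < n → f (pairVec i j) = X i j := by
    intro i j hij hj
    let p : Pairs n := ⟨(⟨i, by omega⟩, ⟨j, hj⟩), hij⟩
    rw [hpair p]
    simp only [f, Fintype.linearCombination_apply_single, one_smul, p]
  have key : ∀ (k : ℕ) (hk : k + 1 < n) (i j : ℕ), i < j → j < n →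
      act (τ (σ k hk)) (f (pairVec i j)) = f (
        if k + 1 = i then (q : ℂ) • pairVec k j + ((q : ℂ) ^ 2 - q) • pairVec k i +
          (1 - (q : ℂ)) • pairVec i j
        else if k = i ∧ k + 1 = j then -((t : ℂ) * (q : ℂ) ^ 2) • pairVec i j
        else if k = i then pairVec (i + 1) j
        else if k + 1 = j then (q : ℂ) • pairVec i k + (1 - (q : ℂ)) • pairVec i j
          - (((q : ℂ) ^ 2 - q) * t) • pairVec k j
        else if k = j then pairVec i (j + 1)
        else pairVec i j) := by
    intro k hk i j hij hj
    rw [hfX i j hij hj, h k hk i j hij hj]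
    split_ifs with c1 c2 c3 c4 c5
    · rw [map_add, map_add, map_smul, map_smul, map_smul, hfX k j (by omega) hj,
        hfX k i (by omega) (by omega), hfX i j hij hj]
    · rw [map_smul, hfX i j hij hj]
    · rw [hfX (i + 1) j (by omega) hj]
    · rw [map_sub, map_add, map_smul, map_smul, map_smul, hfX i k (by omega) (by omega),
        hfX i j hij hj, hfX k j (by omega) hj]
    · rw [hfX i (j + 1) (by omega) (by omega)]
    · rw [hfX i j hij hj]
  obtain ⟨κ, hκ⟩ := exists_subrepresentation τ f hf (by
    intro k hk u
    have hu : (⊤ : Submodule ℂ (Pairs n → ℂ)) ≤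
        (LinearMap.range f).comap ((τ (σ k hk) : W →ₗ[ℂ] W) ∘ₗ f) := by
      rw [← (Pi.basisFun ℂ (Pairs n)).span_eq, Submodule.span_le]
      rintro _ ⟨p, rfl⟩
      rw [Pi.basisFun_apply, ← hpair p]
      exact ⟨_, (key k hk _ _ p.2 p.1.2.2).symm⟩
    exact hu trivial)
  refine ⟨κ, fun k hk i j hij hj => hf ?_, f, hf, hκ⟩
  rw [hκ, key k hk i j hij hj]

theorem linearIndependent_forkVec (n : ℕ) (t : ℂ) :
    LinearIndependent ℂ fun p : Pairs n => forkVec n t p.1.1 p.1.2 := by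
  rw [Fintype.linearIndependent_iff]
  intro c hc ⟨⟨i, j⟩, hij⟩
  -- Among all fork vectors only that of the pair `(i, j)` has a nonzero entry, namely `-1`, in
  -- outer coordinate `j` and inner coordinate `i`. This holds for every `t`.
  have h := congrFun (congrFun hc j) i.castSucc
  simp only [Finset.sum_apply, Pi.smul_apply, Pi.zero_apply] at h
  rw [Finset.sum_eq_single ⟨(i, j), hij⟩] at h
  · have h1 : (i : ℕ) < j := hij
    have h2 : (j : ℕ) ≠ i := by omega
    simpa [forkVec, arcVec, h2, h1.ne, i.2.ne] using h
  · rintro ⟨⟨i', j'⟩, hij'⟩ - hne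
    have h1 : (i : ℕ) < j := hij
    have h2 : (i' : ℕ) < j' := hij'
    have h3 : (i : ℕ) < n := i.2
    simp only [ne_eq, Subtype.ext_iff, Prod.ext_iff, Fin.ext_iff, not_and] at hne
    rw [smul_eq_zero]
    right
    by_cases c1 : (j : ℕ) = i'
    · simp [forkVec, arcVec, c1, show (i : ℕ) ≠ i' by omega, show (i : ℕ) ≠ j' by omega, h3.ne]
    by_cases c2 : (j : ℕ) = j'
    · have c3 : (i : ℕ) ≠ i' := fun e => hne e.symm c2.symm
      simp [forkVec, arcVec, c2, c3, h2.ne', show (i : ℕ) ≠ j' by omega, h3.ne]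
    · simp [forkVec, c1, c2]
  · simp

theorem exists_lawrenceKrammer_of_isLawrence {n : ℕ} {q t : ℂˣ} {ρ : BraidGroup 2 →* GLin ℂ}
    (hρ : ∀ z : ℂ, act (ρ (σ 0 (by norm_num))) z = (t : ℂ) * z)
    {τ : BraidGroup n →* GLin (Fin (∏ j ∈ Finset.range 2, (n + j)) → ℂ)}
    (hτ : IsLawrence ρ q τ) :
    ∃ κ : BraidGroup n →* GLin (Pairs n → ℂ), IsLawrenceKrammer q t κ ∧
      ∃ f : (Pairs n → ℂ) →ₗ[ℂ] (Fin (∏ j ∈ Finset.range 2, (n + j)) → ℂ),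
        Function.Injective f ∧ ∀ b x, f (act (κ b) x) = act (τ b) (f x) := by
  obtain ⟨ρ', hρ', ρ₁, τ₁, hs, ⟨ρ₂, τ₂, hs', h0, h2⟩, h1⟩ := hτ
  let e₁ := flatten (Finset.prod_range_succ (fun j => n + j) 1).symm ℂ
  let e₂ := flatten (Finset.prod_range_succ (fun j => n + j) 0).symm (Fin (n + 1) → ℂ)
  -- The innermost index set has size the empty product `1`, so the constant family identifies the
  -- space of the second step with its single copy; the two flattenings follow.
  let Φ : (Fin n → Fin (n + 1) → ℂ) →ₗ[ℂ] (Fin (∏ j ∈ Finset.range 2, (n + j)) → ℂ) :=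
    e₁.toLinearMap ∘ₗ e₂.toLinearMap ∘ₗ LinearMap.pi fun _ => LinearMap.id
  have hinj : Function.Injective Φ := by
    refine e₁.injective.comp (e₂.injective.comp fun x y hxy => ?_)
    exact congrFun hxy ⟨0, by simp⟩
  have hΦ : ∀ b : BraidGroup n, ∃ hb : b ∈ mixedBraid n 0, ∀ y,
      act (τ b) (Φ y) = Φ (act (ρ₂ ⟨b, hb⟩) y) := by
    intro b
    obtain ⟨hb, h⟩ := h0 b
    refine ⟨hb, fun y => ?_⟩
    refine (h1 b _).trans (congrArg e₁ ((h2 b _).trans (congrArg e₂ ?_)))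
    funext a
    exact h _ a
  refine exists_lawrenceKrammer τ (fun i j => Φ (forkVec n t i j))
    ((linearIndependent_forkVec n t).map' Φ (LinearMap.ker_eq_bot.mpr hinj)) ?_
  intro k hk i j hij hj
  obtain ⟨hb, h⟩ := hΦ (σ k hk)
  rw [h, forkVec_action hρ' hs hρ hs' hk hb hij hj]
  split_ifs <;> simp only [map_add, map_sub, map_smul]

end LongMoody

theorem theorem5p3 :
    (∀ (n m : ℕ) (V : Type*) [AddCommGroup V] [Module ℂ V] (ρ : BraidGroup m →* GLin V),
      ∃! P : ℂˣ → (BraidGroup n →* GLin (Fin (∏ j ∈ Finset.range m, (n + j)) → V)),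
        ∀ q : ℂˣ, IsLawrence ρ q (P q)) ∧
    (∀ (n : ℕ) (q t : ℂˣ) (ρ : BraidGroup 2 →* GLin ℂ),
      (∀ z : ℂ, act (ρ (σ 0 (by norm_num))) z = (t : ℂ) * z) →
      ∀ τ : BraidGroup n →* GLin (Fin (∏ j ∈ Finset.range 2, (n + j)) → ℂ),
        IsLawrence ρ q τ →
        ∃ κ : BraidGroup n →* GLin (Pairs n → ℂ), IsLawrenceKrammer q t κ ∧
          ∃ f : (Pairs n → ℂ) →ₗ[ℂ] (Fin (∏ j ∈ Finset.range 2, (n + j)) → ℂ),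
            Function.Injective f ∧ ∀ (β : BraidGroup n) (x : Pairs n → ℂ),
              f (act (κ β) x) = act (τ β) (f x)) := by
  constructor
  · intro n m V _ _ ρ
    choose P hP hu using existsUnique_isLawrence n ρ
    exact ⟨P, hP, fun P' hP' => funext fun q => hu q _ (hP' q)⟩
  · intro n q t ρ hρ τ hτ
    exact exists_lawrenceKrammer_of_isLawrence hρ hτ
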